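/- Let $\hat q$ (multiplication by $q$) and $\hat p=-i\,\mathrm{d}/\mathrm{d}q$ (on $H^1(\mathbb R)$) be the quadrature operators on the one-mode Hilbert space $L^2(\mathbb R;\mathbb C)$, let $\hat a=(\hat q+i\hat p)/\sqrt2$, and let $\hat n=\hat a^\dagger\hat a$ be the photon number operator. Let $d\ge 2$ be even, $\Delta=\sqrt{2\pi/d}$ and $q_{\max}=\sqrt{\pi d/2}=\Delta d/2$. For $i\in\{-\frac d2,\dots,\frac d2-1\}$ let the box ket $|i\rangle\in L^2(\mathbb R)$ be the function equal to $\Delta^{-1/2}$ on $[i\Delta,(i+1)\Delta)$ and to $0$ elsewhere, and let $\Pi=\sum_{i=-d/2}^{d/2-1}|i\rangle\langle i|$. Let $\rho$ be a density operator (a positive operator of trace one) on $L^2(\mathbb R)$ with $\mathrm{Tr}(\Pi\rho\Pi^\dagger)\neq 0$, and let $\rho_{\rm discr}=\Pi\rho\Pi^\dagger/\mathrm{Tr}(\Pi\rho\Pi^\dagger)$ be its discretised version. Write $\|M\|_{\rm tr}=\frac12\mathrm{Tr}\,|M|$ with $|M|=\sqrt{M^\dagger M}$, write $\bar n=\mathrm{Tr}(\hat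 n\rho)$, and let $\varepsilon=\mathrm{Tr}(1_{\{|\hat q|\ge q_{\max}\}}\,\rho)$ be the probability that a measurement of $\hat q$ gives a result outside of $(-q_{\max},q_{\max})$. The expectation values $\mathrm{Tr}(\hat p^2\rho)$ and $\bar n$ take values in $[0,\infty]$. (a) If the matrix elements $\rho(q,q')=\langle q|\rho|q'\rangle$ vanish (almost everywhere) outside of the square $|q|<q_{\max}\wedge|q'|<q_{\max}$, then $$\|\rho_{\rm discr}-\rho\|_{\rm tr}\le\sqrt{\frac2\pi\cdot\frac{\mathrm{Tr}(\hat p^2\rho)}{d}}\qquad\text{and}\qquad \|\rho_{\rm discr}-\rho\|_{\rm tr}\le\sqrt{\frac4\pi\cdot\frac{\bar n+\frac12}{d}}.$$ (b) In general, without any assumption on the support of $\rho$, $$\|\rho_{\rm discr}-\rho\|_{\rm tr}\le\sqrt{\varepsilon+\frac2\pi\cdot\frac{\mathrm{Tr}(\hat p^2\rho)}{d}}\qquad\text{and}\qquad \|\rho_{\rm discr}-\rho\|_{\rm tr}\le\sqrt{\varepsilon+\frac4\pi\cdot\frac{\bar n+\frac12}{d}}.$$ -/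

import Mathlib

open MeasureTheory
open scoped ENNReal ContDiff

set_option linter.unusedSimpArgs false
set_option linter.unusedSectionVars false

noncomputable section

namespace CV

/-! ### Trace, trace distance and density operators on a Hilbert space -/

section Trace

variable {E : Type*} [NormedAddCommGroup E] [InnerProductSpace ℂ E] [CompleteSpace E]

/-- The index set of a fixed orthonormal (Hilbert) basis of `E`. -/
def basisIndex (E : Type*) [NormedAddCommGroup E] [InnerProductSpace ℂ E] [CompleteSpace E] :
    Set E :=
  (exists_hilbertBasis ℂ E).choose

/-- A fixed orthonormal (Hilbert) basis of `E`. -/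
def basis (E : Type*) [NormedAddCommGroup E] [InnerProductSpace ℂ E] [CompleteSpace E] :
    HilbertBasis (basisIndex E) ℂ E :=
  (exists_hilbertBasis ℂ E).choose_spec.choose

/-- The trace `∑ₙ ⟨eₙ, T eₙ⟩ ∈ [0, ∞]` of a positive operator `T`. It does not depend on the
orthonormal basis, see `trace_eq_tsum`. -/
def trace (T : E →L[ℂ] E) : ℝ≥0∞ :=
  ∑' n, ENNReal.ofReal (inner ℂ (basis E n) (T (basis E n))).re

/-- Parseval's identity. -/
lemma ofReal_norm_sq_eq_tsum {κ : Type*} (c : HilbertBasis κ ℂ E) (x : E) :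
    ENNReal.ofReal (‖x‖ ^ 2) = ∑' k, ENNReal.ofReal (‖inner ℂ (c k) x‖ ^ 2) := by
  have h := c.hasSum_inner_mul_inner x x
  have h2 : HasSum (fun k => ‖inner ℂ (c k) x‖ ^ 2) (‖x‖ ^ 2) := by
    have h3 := Complex.hasSum_re h
    convert h3 using 1
    · funext k
      rw [← inner_conj_symm x (c k), Complex.conj_mul']
      norm_cast
    · rw [← inner_self_eq_norm_sq (𝕜 := ℂ)]
      rfl
  rw [← h2.tsum_eq, ENNReal.ofReal_tsum_of_nonneg (fun k => by positivity) h2.summable]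

/-- The trace of a positive operator can be computed in any orthonormal basis. -/
theorem trace_eq_tsum {ι : Type*} (b : HilbertBasis ι ℂ E) (T : E →L[ℂ] E) (hT : 0 ≤ T) :
    trace T = ∑' i, ENNReal.ofReal (inner ℂ (b i) (T (b i))).re := by
  have hS : IsSelfAdjoint (CFC.sqrt T) := (CFC.sqrt_nonneg T).isSelfAdjoint
  have hST : CFC.sqrt T * CFC.sqrt T = T := CFC.sqrt_mul_sqrt_self T hT
  have hsym : ∀ x y : E, inner ℂ (CFC.sqrt T x) y = inner ℂ x (CFC.sqrt T y) := fun x y => by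
    rw [← ContinuousLinearMap.adjoint_inner_right, hS.adjoint_eq]
  have hq : ∀ x : E, ENNReal.ofReal (inner ℂ x (T x)).re = ENNReal.ofReal (‖CFC.sqrt T x‖ ^ 2) := by
    intro x
    have h1 : inner ℂ x (T x) = inner ℂ (CFC.sqrt T x) (CFC.sqrt T x) := by
      rw [hsym, ← mul_apply_eq_comp, hST]
    rw [h1, ← inner_self_eq_norm_sq (𝕜 := ℂ)]
    rfl
  unfold trace
  simp_rw [hq]
  calc ∑' n, ENNReal.ofReal (‖CFC.sqrt T (basis E n)‖ ^ 2)
      = ∑' n, ∑' i, ENNReal.ofReal (‖inner ℂ (b i) (CFC.sqrt T (basis E n))‖ ^ 2) :=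
        tsum_congr fun n => ofReal_norm_sq_eq_tsum b _
    _ = ∑' i, ∑' n, ENNReal.ofReal (‖inner ℂ (b i) (CFC.sqrt T (basis E n))‖ ^ 2) :=
        ENNReal.tsum_comm
    _ = ∑' i, ENNReal.ofReal (‖CFC.sqrt T (b i)‖ ^ 2) := by
        refine tsum_congr fun i => ?_
        rw [ofReal_norm_sq_eq_tsum (basis E)]
        refine tsum_congr fun n => ?_
        rw [← hsym, norm_inner_symm]

/-- Density operators: positive operators of trace one. -/
def IsDensityOperator (ρ : E →L[ℂ] E) : Prop :=
  0 ≤ ρ ∧ trace ρ = 1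

/-- The trace distance `½ ‖ρ - σ‖₁ = ½ Tr |ρ - σ|`, where `|M| = √(M† M)`. -/
def traceDist (ρ σ : E →L[ℂ] E) : ℝ≥0∞ :=
  1 / 2 * trace (CFC.abs (ρ - σ))

open Classical in
/-- The expectation value `Tr (A† A ρ) = Tr ((A √ρ)† (A √ρ)) = ∑ₙ ‖A √ρ eₙ‖² ∈ [0, ∞]` of the
positive operator `A† A` in the state `ρ`, for a (possibly unbounded) closed operator `A`. It is
infinite if some `√ρ eₙ` lies outside the domain of `A`. -/
def expectAdjMul (A : E →ₗ.[ℂ] E) (ρ : E →L[ℂ] E) : ℝ≥0∞ :=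
  ∑' n, if h : CFC.sqrt ρ (basis E n) ∈ A.domain then
    ‖A ⟨CFC.sqrt ρ (basis E n), h⟩‖ₑ ^ 2 else ⊤

end Trace

/-! ### The one-mode Hilbert space and its quadratures -/

/-- The one-mode Hilbert space `L²(ℝ, ℂ)`, in the `q`-representation. -/
abbrev Mode : Type := Lp ℂ 2 (volume : Measure ℝ)

lemma coe_add_ae (f g : Mode) : ∀ᵐ x ∂(volume : Measure ℝ), (f + g : Mode) x = f x + g x :=
  Lp.coeFn_add f g

lemma coe_smul_ae (c : ℂ) (f : Mode) : ∀ᵐ x ∂(volume : Measure ℝ), (c • f : Mode) x = c * f x :=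
  Lp.coeFn_smul c f

lemma coe_zero_ae : ∀ᵐ x ∂(volume : Measure ℝ), (0 : Mode) x = 0 :=
  Lp.coeFn_zero ℂ 2 volume

/-- The operator `h(q̂)` of multiplication by the function `h`, on its maximal domain
`{f ∈ L² | h f ∈ L²}`. -/
def mulOp (h : ℝ → ℂ) : Mode →ₗ.[ℂ] Mode where
  domain :=
    { carrier := {f | MemLp (fun x => h x * f x) 2 volume}
      add_mem' := by
        intro f g hf hg
        refine (memLp_congr_ae ?_).mp (MemLp.add hf hg)
        filter_upwards [coe_add_ae f g] with x hx
        simp only [Prod.fst_add, Prod.snd_add, Submodule.coe_add, Pi.add_apply, hx, mul_add]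
      zero_mem' := by
        refine (memLp_congr_ae ?_).mp (MemLp.zero (ε := ℂ))
        filter_upwards [coe_zero_ae] with x hx
        simp only [Prod.fst_zero, Prod.snd_zero, Pi.zero_apply, hx, mul_zero]
      smul_mem' := by
        intro c f hf
        refine (memLp_congr_ae ?_).mp (MemLp.const_smul hf c)
        filter_upwards [coe_smul_ae c f] with x hx
        simp only [Prod.smul_fst, Prod.smul_snd, Submodule.coe_smul, Pi.smul_apply, smul_eq_mul, hx, mul_left_comm] }
  toFun :=
    { toFun := fun f => MemLp.toLp (fun x => h x * (f : Mode) x) f.2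
      map_add' := by
        intro f g
        rw [← MemLp.toLp_add]
        refine MemLp.toLp_congr _ _ ?_
        filter_upwards [coe_add_ae (f : Mode) (g : Mode)] with x hx
        simp only [Prod.fst_add, Prod.snd_add, Submodule.coe_add, Pi.add_apply, hx, mul_add]
      map_smul' := by
        intro c f
        rw [RingHom.id_apply, ← MemLp.toLp_const_smul]
        refine MemLp.toLp_congr _ _ ?_
        filter_upwards [coe_smul_ae c (f : Mode)] with x hx
        simp only [Prod.smul_fst, Prod.smul_snd, Submodule.coe_smul, Pi.smul_apply, smul_eq_mul, hx, mul_left_comm] }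

/-- The quadrature `q̂`. -/
def qOp : Mode →ₗ.[ℂ] Mode := mulOp fun x => (x : ℂ)

/-- The spectral projection `1_S(q̂)`: multiplication by the indicator function of `S`. -/
def qProj (S : Set ℝ) : Mode →ₗ.[ℂ] Mode := mulOp (S.indicator 1)

/-- A test function times an `L²` function is integrable. -/
lemma integrable_test_mul {φ : ℝ → ℝ} (hφ : Continuous φ) (hc : HasCompactSupport φ) (f : Mode) :
    Integrable (fun x => (φ x : ℂ) * f x) := by
  have hf : LocallyIntegrable (f : ℝ → ℂ) volume :=
    (Lp.memLp f).locallyIntegrable (by norm_num)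
  have := hf.integrable_smul_left_of_hasCompactSupport hφ hc
  simpa using this

/-- The graph of `p̂ = -i d/dq`: the pairs `(f, g)` in `L² × L²` such that `i g` is the weak
derivative of `f`. -/
def pGraph : Submodule ℂ (Mode × Mode) where
  carrier := {u | ∀ φ : ℝ → ℝ, ContDiff ℝ ∞ φ → HasCompactSupport φ →
    ∫ x, ((deriv φ x : ℝ) : ℂ) * u.1 x = -∫ x, (φ x : ℂ) * (Complex.I * u.2 x)}
  add_mem' := by
    intro u v hu hv φ hφ hc
    have hd : Continuous (deriv φ) := hφ.continuous_deriv (by simp)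
    have h1 : ∫ x, ((deriv φ x : ℝ) : ℂ) * (u + v).1 x =
        (∫ x, ((deriv φ x : ℝ) : ℂ) * u.1 x) + ∫ x, ((deriv φ x : ℝ) : ℂ) * v.1 x := by
      rw [← integral_add (integrable_test_mul hd hc.deriv _) (integrable_test_mul hd hc.deriv _)]
      refine integral_congr_ae ?_
      filter_upwards [coe_add_ae u.1 v.1] with x hx
      simp only [Prod.fst_add, Prod.snd_add, Submodule.coe_add, Pi.add_apply, hx, mul_add]
    have h2 : ∫ x, (φ x : ℂ) * (Complex.I * (u + v).2 x) =
        (∫ x, (φ x : ℂ) * (Complex.I * u.2 x)) + ∫ x, (φ x : ℂ) * (Complex.I * v.2 x) := by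
      have hi : ∀ w : Mode, Integrable fun x => (φ x : ℂ) * (Complex.I * w x) := fun w => by
        refine ((integrable_test_mul hφ.continuous hc w).const_mul Complex.I).congr ?_
        exact Filter.Eventually.of_forall fun x => by simp only []; ring
      rw [← integral_add (hi _) (hi _)]
      refine integral_congr_ae ?_
      filter_upwards [coe_add_ae u.2 v.2] with x hx
      simp only [Prod.fst_add, Prod.snd_add, Submodule.coe_add, Pi.add_apply, hx, mul_add]
    rw [h1, h2, hu φ hφ hc, hv φ hφ hc]
    ring
  zero_mem' := by
    intro φ hφ hc
    have h0 := coe_zero_ae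
    rw [integral_eq_zero_of_ae, integral_eq_zero_of_ae, neg_zero]
    · filter_upwards [h0] with x hx
      simp only [Prod.fst_zero, Prod.snd_zero, Pi.zero_apply, hx, mul_zero]
    · filter_upwards [h0] with x hx
      simp only [Prod.fst_zero, Prod.snd_zero, Pi.zero_apply, hx, mul_zero]
  smul_mem' := by
    intro c u hu φ hφ hc
    have h1 : ∫ x, ((deriv φ x : ℝ) : ℂ) * (c • u).1 x =
        c * ∫ x, ((deriv φ x : ℝ) : ℂ) * u.1 x := by
      rw [← integral_const_mul]
      refine integral_congr_ae ?_
      filter_upwards [coe_smul_ae c u.1] with x hx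
      simp only [Prod.smul_fst, Prod.smul_snd, Submodule.coe_smul, Pi.smul_apply, smul_eq_mul, hx, mul_left_comm]
    have h2 : ∫ x, (φ x : ℂ) * (Complex.I * (c • u).2 x) =
        c * ∫ x, (φ x : ℂ) * (Complex.I * u.2 x) := by
      rw [← integral_const_mul]
      refine integral_congr_ae ?_
      filter_upwards [coe_smul_ae c u.2] with x hx
      simp only [Prod.smul_fst, Prod.smul_snd, Submodule.coe_smul, Pi.smul_apply, smul_eq_mul, hx, mul_left_comm]
    rw [h1, h2, hu φ hφ hc]
    ring

/-- The quadrature `p̂ = -i d/dq`, with domain the Sobolev space `H¹(ℝ)`. -/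
def pOp : Mode →ₗ.[ℂ] Mode := pGraph.toLinearPMap

/-- Weak derivatives are unique, so `pGraph` is indeed the graph of `pOp`. -/
theorem pOp_graph : pOp.graph = pGraph := by
  refine Submodule.toLinearPMap_graph_eq _ ?_
  rintro ⟨f, g⟩ hu hf
  simp only at hf
  subst hf
  have hg : LocallyIntegrable (g : ℝ → ℂ) volume := (Lp.memLp g).locallyIntegrable (by norm_num)
  have h : ∀ᵐ x ∂(volume : Measure ℝ), g x = 0 := by
    refine ae_eq_zero_of_integral_contDiff_smul_eq_zero hg fun φ hφ hc => ?_
    have h1 := hu φ hφ hc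
    have h0 : ∫ x, ((deriv φ x : ℝ) : ℂ) * (0 : Mode) x = 0 := by
      refine integral_eq_zero_of_ae ?_
      filter_upwards [coe_zero_ae] with x hx
      simp only [Prod.fst_zero, Prod.snd_zero, Pi.zero_apply, hx, mul_zero]
    have h2 : ∫ x, (φ x : ℂ) * (Complex.I * g x) = Complex.I * ∫ x, φ x • g x := by
      rw [← integral_const_mul]
      exact integral_congr_ae (Filter.Eventually.of_forall fun x => by simp; ring)
    simp only [h0, h2] at h1
    simpa using h1
  exact (Lp.eq_zero_iff_ae_eq_zero).mpr h

/-- The annihilation operator `â = (q̂ + i p̂) / √2`, on the domain of `q̂` intersected with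
the domain of `p̂`. The photon number operator is `n̂ = â† â`. -/
def annihilation : Mode →ₗ.[ℂ] Mode :=
  ((1 / Real.sqrt 2 : ℝ) : ℂ) • (qOp + Complex.I • pOp)

/-- The expectation value `Tr (p̂² ρ)`, where `p̂² = p̂† p̂`. -/
def momentumSq (ρ : Mode →L[ℂ] Mode) : ℝ≥0∞ := expectAdjMul pOp ρ

/-- The mean photon number `n̄ = Tr (n̂ ρ)`. -/
def meanPhotonNumber (ρ : Mode →L[ℂ] Mode) : ℝ≥0∞ := expectAdjMul annihilation ρ

/-- The probability `Tr (1_S(q̂) ρ) = ∫_S ρ(q, q) dq` that a measurement of `q̂` in the state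
`ρ` gives a result in `S`. -/
def qProb (ρ : Mode →L[ℂ] Mode) (S : Set ℝ) : ℝ≥0∞ := expectAdjMul (qProj S) ρ

/-- `K(q, q') = ⟨q| ρ |q'⟩` are the matrix elements of `ρ`: `K` is square integrable and
`⟨f, ρ g⟩ = ∬ f(q)* K(q, q') g(q') dq dq'` for all `f` and `g`. -/
def HasMatrixElements (ρ : Mode →L[ℂ] Mode) (K : ℝ × ℝ → ℂ) : Prop :=
  MemLp K 2 volume ∧
    ∀ f g : Mode, inner ℂ f (ρ g) = ∫ z : ℝ × ℝ, star (f z.1) * K z * g z.2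

/-- The matrix elements of `ρ` vanish outside of the square `|q| < R ∧ |q'| < R`. -/
def SupportedIn (ρ : Mode →L[ℂ] Mode) (R : ℝ) : Prop :=
  ∃ K, HasMatrixElements ρ K ∧ ∀ᵐ z : ℝ × ℝ, ¬(|z.1| < R ∧ |z.2| < R) → K z = 0

/-! ### Discretisation -/

/-- The width `Δ = √(2π/d)` of the boxes. -/
def boxWidth (d : ℕ) : ℝ := Real.sqrt (2 * Real.pi / d)

/-- The cutoff `q_max = √(πd/2) = Δ d / 2`. -/
def qMax (d : ℕ) : ℝ := Real.sqrt (Real.pi * d / 2)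

/-- The box ket `|i⟩ = Δ^(-1/2) ∫₀^Δ |q = iΔ + x⟩ dx`, that is, the function `Δ^(-1/2)` on
`[iΔ, (i+1)Δ)` and `0` elsewhere. -/
def boxKet (d : ℕ) (i : ℤ) : Mode :=
  indicatorConstLp 2 (measurableSet_Ico (a := i * boxWidth d) (b := (i + 1) * boxWidth d))
    measure_Ico_lt_top.ne ((1 / Real.sqrt (boxWidth d) : ℝ) : ℂ)

/-- The projection `Π = ∑ |i⟩⟨i|` onto the box kets with `i ∈ {-d/2, …, d/2 - 1}`. -/
def boxProj (d : ℕ) : Mode →L[ℂ] Mode :=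
  ∑ i ∈ Finset.Ico (-((d : ℤ) / 2)) ((d : ℤ) / 2),
    InnerProductSpace.rankOne ℂ (boxKet d i) (boxKet d i)

/-- `Π ρ Π†`. -/
def compress (d : ℕ) (ρ : Mode →L[ℂ] Mode) : Mode →L[ℂ] Mode :=
  boxProj d ∘L ρ ∘L (ContinuousLinearMap.adjoint (boxProj d))

/-- The discretised state `ρ_discr = Π ρ Π† / Tr (Π ρ Π†)`. -/
def discretise (d : ℕ) (ρ : Mode →L[ℂ] Mode) : Mode →L[ℂ] Mode :=
  (((trace (compress d ρ)).toReal⁻¹ : ℝ) : ℂ) • compress d ρ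

end CV

end

noncomputable section

namespace CV

/-! ### Hilbert–Schmidt estimates and gentle measurement -/

section HilbertSchmidt

variable {E : Type*} [NormedAddCommGroup E] [InnerProductSpace ℂ E] [CompleteSpace E]

open ContinuousLinearMap (adjoint)

/-! The box kets are orthonormal, so `Π` is an orthogonal projection and discretisation is a
projective measurement followed by renormalisation. Two independent facts then give the bounds.

The first is a gentle measurement lemma for mixed states, `traceDist_compression_le`: the trace
distance is at most the square root of the lost weight `1 - Tr(Πρ)`. With `R = √ρ` and `A =
ΠR/√Tr(Πρ)`, the difference `AA† - RR†` is half of `(A+R)(A-R)† + (A-R)(A+R)†`. Hölder's inequality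
bounds its trace norm by the product of the Hilbert–Schmidt norms of `A+R` and `A-R`, and these are
explicit because `⟨ΠR, R⟩ = ‖ΠR‖²`. So no purification is needed.

The second bounds the lost weight. For a wave function `ψ`, `Π` replaces `ψ` on each box by its mean
and discards everything beyond `q_max`. The Poincaré–Wirtinger inequality with optimal constant
`(Δ/π)² = 2/(πd)` controls the first loss by `‖p̂ψ‖²`; the second is the tail. Applying this to `ψ =
√ρ eₙ` and summing over `n` gives `ε + (2/π) Tr(p̂²ρ)/d` (`hsSq_sqrtOp_le`).

The photon number version follows from `‖p̂ψ‖² ≤ 2‖âψ‖² + ‖ψ‖²`, a one-sided commutation relation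
(`norm_sq_pOp_le`). Part (a) is part (b) with `ε = 0`, which the support condition forces
(`qProb_eq_zero_of_supportedIn`). -/

lemma ofReal_norm_sq {F : Type*} [SeminormedAddCommGroup F] (x : F) :
    ENNReal.ofReal (‖x‖ ^ 2) = ‖x‖ₑ ^ 2 := by
  rw [ENNReal.ofReal_pow (norm_nonneg x), ofReal_norm]

/-- The squared Hilbert–Schmidt norm. -/
def hsSq (T : E →L[ℂ] E) : ℝ≥0∞ := ∑' n, ‖T (basis E n)‖ₑ ^ 2

/-- By Parseval both sides are the double sum of the squared moduli of the matrix entries, and the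
order of summation is free in `ℝ≥0∞`. -/
lemma hsSq_adjoint (T : E →L[ℂ] E) : hsSq (adjoint T) = hsSq T := by
  unfold hsSq
  simp_rw [← ofReal_norm_sq, ofReal_norm_sq_eq_tsum (basis E)]
  rw [ENNReal.tsum_comm]
  refine tsum_congr fun n => tsum_congr fun k => ?_
  rw [ContinuousLinearMap.adjoint_inner_right, norm_inner_symm]

lemma hsSq_comp_le_of_norm_le_one (S T : E →L[ℂ] E) (hS : ‖S‖ ≤ 1) : hsSq (S ∘L T) ≤ hsSq T := by
  refine ENNReal.tsum_le_tsum fun n => ?_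
  gcongr
  rw [← ofReal_norm, ← ofReal_norm]
  refine ENNReal.ofReal_le_ofReal ?_
  exact (S.le_opNorm _).trans (mul_le_of_le_one_left (norm_nonneg _) hS)

lemma hsSq_comp_le_of_norm_le_one_right (S T : E →L[ℂ] E) (hS : ‖S‖ ≤ 1) :
    hsSq (T ∘L S) ≤ hsSq T := by
  rw [← hsSq_adjoint, ContinuousLinearMap.adjoint_comp, ← hsSq_adjoint T]
  refine hsSq_comp_le_of_norm_le_one _ _ ?_
  rwa [LinearIsometryEquiv.norm_map]

lemma trace_adjoint_comp_self (T : E →L[ℂ] E) : trace (adjoint T ∘L T) = hsSq T := by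
  refine tsum_congr fun n => ?_
  rw [ContinuousLinearMap.comp_apply, ContinuousLinearMap.adjoint_inner_right,
    ← ofReal_norm_sq, ← inner_self_eq_norm_sq (𝕜 := ℂ)]
  rfl

/-- The positive square root of a positive operator. -/
def sqrtOp (ρ : E →L[ℂ] E) : E →L[ℂ] E := CFC.sqrt ρ

open Classical in
lemma expectAdjMul_eq_tsum (A : E →ₗ.[ℂ] E) (ρ : E →L[ℂ] E) :
    expectAdjMul A ρ = ∑' n, if h : sqrtOp ρ (basis E n) ∈ A.domain then
      ‖A ⟨sqrtOp ρ (basis E n), h⟩‖ₑ ^ 2 else ⊤ :=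
  rfl

lemma adjoint_sqrtOp (ρ : E →L[ℂ] E) : adjoint (sqrtOp ρ) = sqrtOp ρ :=
  (CFC.sqrt_nonneg ρ).isSelfAdjoint.adjoint_eq

lemma sqrtOp_comp_sqrtOp {ρ : E →L[ℂ] E} (hρ : 0 ≤ ρ) : sqrtOp ρ ∘L sqrtOp ρ = ρ :=
  CFC.sqrt_mul_sqrt_self ρ hρ

lemma trace_eq_hsSq_sqrtOp {ρ : E →L[ℂ] E} (hρ : 0 ≤ ρ) : trace ρ = hsSq (sqrtOp ρ) := by
  rw [← trace_adjoint_comp_self, adjoint_sqrtOp, sqrtOp_comp_sqrtOp hρ]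

/-- A substitute for the polar decomposition `|M| = sgn(M) M`. The sign is discontinuous, so it is
replaced by the ramp `x/δ` clipped to `[-1, 1]`, which lies within the continuous functional
calculus; the price is the error `δ`. -/
lemma exists_contraction_abs_le {M : E →L[ℂ] E} (hM : IsSelfAdjoint M) {δ : ℝ} (hδ : 0 < δ) :
    ∃ S : E →L[ℂ] E, ‖S‖ ≤ 1 ∧ adjoint S = S ∧
      CFC.abs M ≤ S ∘L M + (δ : ℂ) • ContinuousLinearMap.id ℂ E := by
  set g : ℝ → ℝ := fun x => max (-1) (min 1 (x / δ)) with hg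
  have hgc : Continuous g := by fun_prop
  refine ⟨cfc g M, ?_, ?_, ?_⟩
  · refine norm_cfc_le zero_le_one fun x _ => ?_
    rw [Real.norm_eq_abs, abs_le]
    exact ⟨le_max_left _ _, max_le (by norm_num) (min_le_left _ _)⟩
  · exact (cfc_predicate g M).adjoint_eq
  · have h1 : cfc g M ∘L M + (δ : ℂ) • ContinuousLinearMap.id ℂ E
        = cfc (fun x => g x * x + δ) M := by
      rw [cfc_add M (fun x => g x * x) (fun _ => δ) (by fun_prop) (by fun_prop),
        cfc_mul g (fun x => x) M (by fun_prop) (by fun_prop), cfc_id' ℝ M, cfc_const δ M]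
      rfl
    rw [h1, CFC.abs_eq_cfc_norm M hM]
    refine cfc_mono (fun x _ => ?_) (by fun_prop) (by fun_prop)
    simp only [hg, Real.norm_eq_abs]
    rcases le_total x (-δ) with h | h
    · have h2 : x / δ ≤ -1 := by rw [div_le_iff₀ hδ]; linarith
      rw [min_eq_right (by linarith), max_eq_left h2, abs_of_nonpos (by linarith)]
      linarith
    rcases le_total x δ with h' | h'
    · have h2 : -1 ≤ x / δ := by rw [le_div_iff₀ hδ]; linarith
      have h3 : x / δ ≤ 1 := by rw [div_le_iff₀ hδ]; linarith
      rw [min_eq_right h3, max_eq_right h2]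
      have : 0 ≤ x / δ * x := by
        rw [div_mul_eq_mul_div]; exact div_nonneg (mul_self_nonneg x) hδ.le
      have := abs_le.mpr ⟨h, h'⟩
      linarith
    · have h3 : 1 ≤ x / δ := by rw [le_div_iff₀ hδ]; linarith
      rw [min_eq_left h3, max_eq_right (by norm_num), abs_of_nonneg (by linarith)]
      linarith

lemma sum_enorm_mul_enorm_le (F : Finset (basisIndex E)) (A B : E →L[ℂ] E) :
    ∑ n ∈ F, ‖A (basis E n)‖ₑ * ‖B (basis E n)‖ₑ ≤
      hsSq A ^ (1 / 2 : ℝ) * hsSq B ^ (1 / 2 : ℝ) := by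
  refine (ENNReal.inner_le_Lp_mul_Lq F _ _ Real.HolderConjugate.two_two).trans ?_
  simp only [ENNReal.rpow_two]
  gcongr <;> exact ENNReal.sum_le_tsum F

/-- Hölder's inequality `‖U V† + V U†‖₁ ≤ 2 ‖U‖₂ ‖V‖₂`. -/
lemma trace_abs_le_of_two_smul_eq {M U V : E →L[ℂ] E} (hM : IsSelfAdjoint M)
    (h : (2 : ℂ) • M = U ∘L adjoint V + V ∘L adjoint U) :
    trace (CFC.abs M) ≤ hsSq U ^ (1 / 2 : ℝ) * hsSq V ^ (1 / 2 : ℝ) := by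
  refine ENNReal.summable.tsum_le_of_sum_le fun F => ?_
  set B := hsSq U ^ (1 / 2 : ℝ) * hsSq V ^ (1 / 2 : ℝ) with hB
  -- The operator `δ • id` has infinite trace in infinite dimension, so only finite partial sums are
  -- estimated; their error `card F * δ` vanishes as `δ → 0`.
  have key : ∀ δ : ℝ, 0 < δ →
      ∑ n ∈ F, ENNReal.ofReal (inner ℂ (basis E n) (CFC.abs M (basis E n))).re ≤
        B + F.card * ENNReal.ofReal δ := by
    intro δ hδ
    obtain ⟨S, hS1, hSa, hSM⟩ := exists_contraction_abs_le hM hδ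
    have hsum : ∀ A B : E →L[ℂ] E, ∑ n ∈ F, ‖(adjoint A ∘L S) (basis E n)‖ₑ *
        ‖adjoint B (basis E n)‖ₑ ≤ hsSq A ^ (1 / 2 : ℝ) * hsSq B ^ (1 / 2 : ℝ) := fun A B => by
      refine (sum_enorm_mul_enorm_le F _ _).trans ?_
      gcongr
      · exact (hsSq_comp_le_of_norm_le_one_right _ _ hS1).trans (hsSq_adjoint A).le
      · exact (hsSq_adjoint B).le
    have hterm : ∀ n, ENNReal.ofReal (inner ℂ (basis E n) (CFC.abs M (basis E n))).re ≤
        2⁻¹ * (‖(adjoint U ∘L S) (basis E n)‖ₑ * ‖adjoint V (basis E n)‖ₑ) +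
        2⁻¹ * (‖(adjoint V ∘L S) (basis E n)‖ₑ * ‖adjoint U (basis E n)‖ₑ) +
          ENNReal.ofReal δ := by
      intro n
      set e := basis E n
      have he : ‖e‖ = 1 := (basis E).orthonormal.1 n
      have h1 := (ContinuousLinearMap.le_def _ _).mp hSM
      have h2 := h1.re_inner_nonneg_right e
      have h3 : inner ℂ e (S (M e)) = 2⁻¹ * (inner ℂ (adjoint U (S e)) (adjoint V e) +
          inner ℂ (adjoint V (S e)) (adjoint U e)) := by
        have h4 : inner ℂ e (S (M e)) = inner ℂ (S e) (M e) := by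
          conv_rhs => rw [← hSa]
          rw [ContinuousLinearMap.adjoint_inner_left]
        have h5 : M e = (2⁻¹ : ℂ) • (U (adjoint V e) + V (adjoint U e)) := by
          have := congrArg (fun T : E →L[ℂ] E => (2⁻¹ : ℂ) • T e) h
          simpa [smul_smul] using this
        rw [h4, h5, inner_smul_right, inner_add_right, ContinuousLinearMap.adjoint_inner_left,
          ContinuousLinearMap.adjoint_inner_left]
      have h6 : (inner ℂ e (CFC.abs M e)).re ≤
          2⁻¹ * (‖(adjoint U ∘L S) e‖ * ‖adjoint V e‖) +
          2⁻¹ * (‖(adjoint V ∘L S) e‖ * ‖adjoint U e‖) + δ := by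
        have h7 : (inner ℂ e (CFC.abs M e)).re ≤ (inner ℂ e (S (M e))).re + δ := by
          simp only [sub_apply, add_apply,
            ContinuousLinearMap.comp_apply, smul_apply,
            ContinuousLinearMap.id_apply, inner_sub_right, inner_add_right, inner_smul_right,
            inner_self_eq_norm_sq_to_K, he] at h2
          simp at h2
          linarith
        have h8 := (Complex.re_le_norm _).trans (norm_inner_le_norm (𝕜 := ℂ) (adjoint U (S e)) (adjoint V e))
        have h9 := (Complex.re_le_norm _).trans (norm_inner_le_norm (𝕜 := ℂ) (adjoint V (S e)) (adjoint U e))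
        have h10 : (inner ℂ e (S (M e))).re = 2⁻¹ * ((inner ℂ (adjoint U (S e)) (adjoint V e)).re +
          (inner ℂ (adjoint V (S e)) (adjoint U e)).re) := by
          rw [h3]
          have : (2⁻¹ : ℂ) = ((2⁻¹ : ℝ) : ℂ) := by push_cast; rfl
          rw [this, Complex.re_ofReal_mul, Complex.add_re]
        simp only [ContinuousLinearMap.comp_apply]
        linarith
      refine (ENNReal.ofReal_le_ofReal h6).trans (le_of_eq ?_)
      rw [ENNReal.ofReal_add (by positivity) hδ.le, ENNReal.ofReal_add (by positivity) (by positivity)]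
      simp only [ENNReal.ofReal_mul, inv_nonneg, Nat.ofNat_nonneg, norm_nonneg, ofReal_norm]
      rw [ENNReal.ofReal_inv_of_pos (by norm_num), ENNReal.ofReal_ofNat]
    refine (Finset.sum_le_sum fun n _ => hterm n).trans ?_
    rw [Finset.sum_add_distrib, Finset.sum_add_distrib, ← Finset.mul_sum, ← Finset.mul_sum,
      Finset.sum_const, nsmul_eq_mul]
    gcongr
    calc _ ≤ 2⁻¹ * B + 2⁻¹ * B := by
          gcongr
          · exact hsum U V
          · exact (hsum V U).trans (mul_comm _ _).le
      _ = B := by rw [← add_mul, ENNReal.inv_two_add_inv_two, one_mul]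
  refine ENNReal.le_of_forall_pos_le_add fun ε hε _ => ?_
  have hc : (0 : ℝ) < F.card + 1 := by positivity
  refine (key (ε / (F.card + 1)) (by positivity)).trans ?_
  gcongr
  rw [← ENNReal.ofReal_natCast, ← ENNReal.ofReal_mul (by positivity), ← ENNReal.ofReal_coe_nnreal]
  refine ENNReal.ofReal_le_ofReal ?_
  rw [mul_div_assoc', div_le_iff₀ hc]
  nlinarith [ε.coe_nonneg]

/-- The gentle measurement lemma for a projective measurement. -/
theorem traceDist_compression_le {P ρ : E →L[ℂ] E} (hPa : adjoint P = P) (hPP : P ∘L P = P)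
    (hρ : IsDensityOperator ρ) (hp : trace (P ∘L ρ ∘L adjoint P) ≠ 0) :
    traceDist ((((trace (P ∘L ρ ∘L adjoint P)).toReal⁻¹ : ℝ) : ℂ) • (P ∘L ρ ∘L adjoint P)) ρ ≤
      (1 - hsSq (P ∘L sqrtOp ρ)) ^ (1 / 2 : ℝ) := by
  obtain ⟨hρ0, hρ1⟩ := hρ
  set R := sqrtOp ρ with hR
  have hRa : adjoint R = R := adjoint_sqrtOp ρ
  have hRR : R ∘L R = ρ := sqrtOp_comp_sqrtOp hρ0
  have htr : trace (P ∘L ρ ∘L adjoint P) = hsSq (P ∘L R) := by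
    rw [← hsSq_adjoint, ← trace_adjoint_comp_self, ContinuousLinearMap.adjoint_adjoint,
      ContinuousLinearMap.adjoint_comp, hRa, ← hRR]
    rfl
  have hR1 : hsSq R = 1 := by rw [← trace_eq_hsSq_sqrtOp hρ0, hρ1]
  have hinner : ∀ x, inner ℂ (P x) x = inner ℂ (P x) (P x) := fun x => by
    rw [← ContinuousLinearMap.adjoint_inner_left, hPa, ← ContinuousLinearMap.comp_apply, hPP]
  have hP1 : ‖P‖ ≤ 1 := by
    refine P.opNorm_le_bound zero_le_one fun x => ?_
    rw [one_mul]
    have h1 : ‖P x‖ * ‖P x‖ ≤ ‖P x‖ * ‖x‖ := by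
      have h2 := norm_inner_le_norm (𝕜 := ℂ) (P x) x
      rw [hinner, inner_self_eq_norm_sq_to_K] at h2
      simpa [sq] using h2
    rcases (norm_nonneg (P x)).eq_or_lt with h0 | h0
    · rw [← h0]; exact norm_nonneg x
    · exact le_of_mul_le_mul_left h1 h0
  rw [htr] at hp ⊢
  set p := hsSq (P ∘L R) with hpdef
  have hp1 : p ≤ 1 := hR1 ▸ hsSq_comp_le_of_norm_le_one P R hP1
  have hptop : p ≠ ⊤ := (hp1.trans_lt ENNReal.one_lt_top).ne
  set q := p.toReal with hq
  have hpq : p = ENNReal.ofReal q := (ENNReal.ofReal_toReal hptop).symm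
  have hq0 : 0 < q := ENNReal.toReal_pos hp hptop
  have hq1 : q ≤ 1 := ENNReal.toReal_le_of_le_ofReal zero_le_one (by simpa using hp1)
  set s := Real.sqrt q with hs
  have hs0 : 0 < s := Real.sqrt_pos.mpr hq0
  have hss : s * s = q := Real.mul_self_sqrt hq0.le
  have hs1 : s ≤ 1 := Real.sqrt_le_one.mpr hq1
  set c : ℂ := ((s⁻¹ : ℝ) : ℂ) with hc
  have hcc : c * c = ((q⁻¹ : ℝ) : ℂ) := by
    rw [hc, ← Complex.ofReal_mul, ← mul_inv, hss]
  have hcs : (starRingEnd ℂ) c = c := Complex.conj_ofReal _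
  -- Sum and difference of the square-root factors: `U V† + V U†` loses its cross terms and leaves
  -- twice the difference of the states.
  set U : E →L[ℂ] E := c • (P ∘L R) + R with hU
  set V : E →L[ℂ] E := c • (P ∘L R) - R with hV
  have hadj : adjoint (c • (P ∘L R)) = c • (R ∘L P) := by
    rw [map_smulₛₗ, hcs, ContinuousLinearMap.adjoint_comp, hRa, hPa]
  have hUa : adjoint U = c • (R ∘L P) + R := by rw [hU, map_add, hadj, hRa]
  have hVa : adjoint V = c • (R ∘L P) - R := by rw [hV, map_sub, hadj, hRa]
  set M := ((q⁻¹ : ℝ) : ℂ) • (P ∘L ρ ∘L adjoint P) - ρ with hMdef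
  have hMs : IsSelfAdjoint M := by
    rw [ContinuousLinearMap.isSelfAdjoint_iff', hMdef]
    rw [map_sub, map_smulₛₗ, Complex.conj_ofReal, ContinuousLinearMap.adjoint_comp,
      ContinuousLinearMap.adjoint_comp, ContinuousLinearMap.adjoint_adjoint,
      hρ0.isSelfAdjoint.adjoint_eq]
    rfl
  have h2M : (2 : ℂ) • M = U ∘L adjoint V + V ∘L adjoint U := by
    rw [hUa, hVa, hMdef, ← hcc, hPa, ← hRR]
    ext x
    simp only [hU, hV, add_apply, sub_apply,
      smul_apply, ContinuousLinearMap.comp_apply, map_add, map_sub, map_smul]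
    module
  have hUV := trace_abs_le_of_two_smul_eq hMs h2M
  have hexp : ∀ x, ‖c • P x + x‖ ^ 2 = (q⁻¹ + 2 * s⁻¹) * ‖P x‖ ^ 2 + ‖x‖ ^ 2 ∧
      ‖c • P x - x‖ ^ 2 + 2 * s⁻¹ * ‖P x‖ ^ 2 = q⁻¹ * ‖P x‖ ^ 2 + ‖x‖ ^ 2 := by
    intro x
    have h1 : RCLike.re (inner ℂ (c • P x) x) = s⁻¹ * ‖P x‖ ^ 2 := by
      rw [inner_smul_left, hinner, hcs, inner_self_eq_norm_sq_to_K, hc]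
      exact (congrArg Complex.re (by push_cast; rfl :
        _ = ((s⁻¹ * ‖P x‖ ^ 2 : ℝ) : ℂ))).trans (Complex.ofReal_re _)
    have h2 : ‖c • P x‖ ^ 2 = q⁻¹ * ‖P x‖ ^ 2 := by
      rw [norm_smul, mul_pow, hc, Complex.norm_real, Real.norm_eq_abs, sq_abs, ← hss, mul_inv, sq]
    rw [@norm_add_sq ℂ, @norm_sub_sq ℂ, h1, h2]
    constructor <;> ring
  have hpU : hsSq U = ENNReal.ofReal (2 + 2 * s) := by
    have h1 : hsSq U = ENNReal.ofReal (q⁻¹ + 2 * s⁻¹) * p + hsSq R := by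
      rw [hpdef, hsSq, hsSq, hsSq, ← ENNReal.tsum_mul_left, ← ENNReal.tsum_add]
      refine tsum_congr fun n => ?_
      simp only [← ofReal_norm_sq]
      rw [← ENNReal.ofReal_mul (by positivity), ← ENNReal.ofReal_add (by positivity) (by positivity)]
      exact congrArg _ (hexp _).1
    rw [h1, hR1, hpq, ← ENNReal.ofReal_mul (by positivity), ← ENNReal.ofReal_one,
      ← ENNReal.ofReal_add (by positivity) (by positivity), ← hss]
    congr 1
    field_simp
    ring
  have hpV : hsSq V = ENNReal.ofReal (2 - 2 * s) := by
    -- The negative cross term stands on the left because subtraction in `ℝ≥0∞` truncates; being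
    -- finite, it can be cancelled afterwards.
    have h1 : hsSq V + ENNReal.ofReal (2 * s⁻¹) * p = ENNReal.ofReal q⁻¹ * p + hsSq R := by
      rw [hpdef, hsSq, hsSq, hsSq, ← ENNReal.tsum_mul_left, ← ENNReal.tsum_mul_left,
        ← ENNReal.tsum_add, ← ENNReal.tsum_add]
      refine tsum_congr fun n => ?_
      simp only [← ofReal_norm_sq]
      rw [← ENNReal.ofReal_mul (by positivity), ← ENNReal.ofReal_mul (by positivity),
        ← ENNReal.ofReal_add (by positivity) (by positivity),
        ← ENNReal.ofReal_add (by positivity) (by positivity)]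
      exact congrArg _ (hexp _).2
    rw [hR1, hpq, ← ENNReal.ofReal_mul (by positivity), ← ENNReal.ofReal_mul (by positivity),
      ← ENNReal.ofReal_one, ← ENNReal.ofReal_add (by positivity) (by positivity)] at h1
    refine (ENNReal.add_left_inj (ENNReal.ofReal_ne_top (r := 2 * s⁻¹ * q))).mp ?_
    rw [h1, ← ENNReal.ofReal_add (by linarith) (by positivity), ← hss]
    congr 1
    field_simp
    ring
  rw [traceDist]
  refine (mul_le_mul_right hUV (1 / 2)).trans (le_of_eq ?_)
  rw [hpU, hpV, ← ENNReal.mul_rpow_of_nonneg _ _ (by norm_num),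
    ← ENNReal.ofReal_mul (by positivity), hpq, ← ENNReal.ofReal_one,
    ← ENNReal.ofReal_sub _ hq0.le, show (2 + 2 * s) * (2 - 2 * s) = 4 * (1 - q) by rw [← hss]; ring,
    ENNReal.ofReal_mul (by norm_num), ENNReal.mul_rpow_of_nonneg _ _ (by norm_num), ← mul_assoc]
  have h4 : (1 / 2 : ℝ≥0∞) * ENNReal.ofReal 4 ^ (1 / 2 : ℝ) = 1 := by
    rw [show (4 : ℝ) = 2 ^ 2 by norm_num, ENNReal.ofReal_pow (by norm_num), ← ENNReal.rpow_two,
      ← ENNReal.rpow_mul]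
    norm_num
    exact ENNReal.inv_mul_cancel (by norm_num) (by norm_num)
  rw [ENNReal.ofReal_one] at *
  rw [h4, one_mul]

end HilbertSchmidt


/-! ### Weak derivatives and Poincaré–Wirtinger on the real line -/

section Sobolev

open Set Filter Topology

/-- `g` is the weak derivative of `u`. -/
def HasWeakDeriv (u g : ℝ → ℝ) : Prop :=
  ∀ φ : ℝ → ℝ, ContDiff ℝ ∞ φ → HasCompactSupport φ → ∫ x, deriv φ x * u x = -∫ x, φ x * g x

lemma intervalIntegrable_of_locallyIntegrable {g : ℝ → ℝ} (hg : LocallyIntegrable g) (a b : ℝ) :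
    IntervalIntegrable g volume a b :=
  (hg.integrableOn_isCompact isCompact_uIcc).intervalIntegrable

/-- Moves the base point from `0` to `a`: absolute continuity of an integral on `[a, b]` is
available for base points in that interval, which need not contain `0`. -/
lemma primitive_eq_add {g : ℝ → ℝ} (hg : LocallyIntegrable g) (c a : ℝ) :
    (fun x => c + ∫ t in (0 : ℝ)..x, g t) =
      (fun _ => c + ∫ t in (0 : ℝ)..a, g t) + fun x => ∫ t in a..x, g t := by
  have hi : ∀ a b, IntervalIntegrable g volume a b := intervalIntegrable_of_locallyIntegrable hg
  funext x
  simp only [Pi.add_apply, add_assoc, intervalIntegral.integral_add_adjacent_intervals (hi _ _) (hi _ _)]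

lemma absolutelyContinuousOnInterval_primitive {g : ℝ → ℝ} (hg : LocallyIntegrable g) (c a b : ℝ) :
    AbsolutelyContinuousOnInterval (fun x => c + ∫ t in (0 : ℝ)..x, g t) a b := by
  rw [primitive_eq_add hg c a]
  exact (contDiffOn_const.absolutelyContinuousOnInterval).add
    ((intervalIntegrable_of_locallyIntegrable hg a b).absolutelyContinuousOnInterval_intervalIntegral left_mem_uIcc)

lemma continuous_primitive {g : ℝ → ℝ} (hg : LocallyIntegrable g) (c : ℝ) :
    Continuous fun x => c + ∫ t in (0 : ℝ)..x, g t :=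
  continuous_const.add
    (intervalIntegral.continuous_primitive (intervalIntegrable_of_locallyIntegrable hg) 0)

lemma ae_hasDerivAt_primitive {g : ℝ → ℝ} (hg : LocallyIntegrable g) (c : ℝ) :
    ∀ᵐ x, HasDerivAt (fun x => c + ∫ t in (0 : ℝ)..x, g t) (g x) x := by
  filter_upwards [_root_.LocallyIntegrable.ae_hasDerivAt_integral hg] with x hx
  exact (hx 0).const_add c

/-- Integration by parts against a primitive. -/
lemma integral_deriv_mul_primitive {g G : ℝ → ℝ} (hg : LocallyIntegrable g) (c a b : ℝ)
    (hG : AbsolutelyContinuousOnInterval G a b) :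
    ∫ x in a..b, deriv G x * (c + ∫ t in (0 : ℝ)..x, g t) + G x * g x =
      G b * (c + ∫ t in (0 : ℝ)..b, g t) - G a * (c + ∫ t in (0 : ℝ)..a, g t) := by
  rw [← hG.integral_deriv_mul_eq_sub (absolutelyContinuousOnInterval_primitive hg c a b)]
  refine intervalIntegral.integral_congr_ae ?_
  filter_upwards [ae_hasDerivAt_primitive hg c] with x hx _
  rw [hx.deriv]

lemma exists_support_subset_Ioc {f : ℝ → ℝ} (hf : HasCompactSupport f) :
    ∃ N : ℝ, 0 < N ∧ ∀ x, N ≤ |x| → f x = 0 := by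
  obtain ⟨N, hN0, hN⟩ := hf.isBounded.exists_pos_norm_lt
  refine ⟨N, hN0, fun x hx => ?_⟩
  by_contra h
  exact absurd (hN x (subset_tsupport f h)) (not_lt.mpr hx)

lemma integral_eq_of_vanish {f : ℝ → ℝ} {N : ℝ} (hf : ∀ x, N ≤ |x| → f x = 0) :
    ∫ x in (-N)..N, f x = ∫ x, f x := by
  refine intervalIntegral.integral_eq_integral_of_support_subset fun x hx => ?_
  have h1 : |x| < N := by
    by_contra h
    exact hx (hf x (not_lt.mp h))
  exact ⟨(abs_lt.mp h1).1, (abs_lt.mp h1).2.le⟩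

/-- The primitive started to the left of the support vanishes there, and vanishes to the right of it
because the total integral is zero. -/
lemma exists_primitive_of_integral_eq_zero {θ : ℝ → ℝ} (hθ : ContDiff ℝ ∞ θ)
    (hc : HasCompactSupport θ) (h0 : ∫ x, θ x = 0) :
    ∃ φ : ℝ → ℝ, ContDiff ℝ ∞ φ ∧ HasCompactSupport φ ∧ deriv φ = θ := by
  obtain ⟨N, hN0, hN⟩ := exists_support_subset_Ioc hc
  have hd : ∀ x, HasDerivAt (fun y => ∫ t in (-N)..y, θ t) (θ x) x := fun x =>
    (hθ.continuous.integral_hasStrictDerivAt (-N) x).hasDerivAt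
  have hderiv : deriv (fun y => ∫ t in (-N)..y, θ t) = θ := funext fun x => (hd x).deriv
  have hi : ∀ a b, IntervalIntegrable θ volume a b := fun a b => hθ.continuous.intervalIntegrable a b
  refine ⟨_, ?_, ?_, hderiv⟩
  · rw [contDiff_infty_iff_deriv, hderiv]
    exact ⟨fun x => (hd x).differentiableAt, hθ⟩
  · refine HasCompactSupport.intro (isCompact_Icc (a := -N) (b := N)) fun x hx => ?_
    have hx' : x < -N ∨ N < x := by
      by_contra! h
      exact hx ⟨h.1, h.2⟩
    rcases hx' with h | h
    · refine intervalIntegral.integral_zero_ae (Eventually.of_forall fun y hy => hN y ?_)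
      rw [uIoc_of_ge h.le] at hy
      rw [abs_of_nonpos (by linarith [hy.2])]
      linarith [hy.2]
    · rw [← intervalIntegral.integral_add_adjacent_intervals (hi (-N) N) (hi N x),
        integral_eq_of_vanish hN, h0, zero_add]
      refine intervalIntegral.integral_zero_ae (Eventually.of_forall fun y hy => hN y ?_)
      rw [uIoc_of_le h.le] at hy
      rw [abs_of_nonneg (by linarith [hy.1])]
      exact hy.1.le

lemma integrable_mul_of_hasCompactSupport {φ u : ℝ → ℝ} (hφ : Continuous φ)
    (hc : HasCompactSupport φ) (hu : LocallyIntegrable u) : Integrable fun x => φ x * u x := by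
  simpa using hu.integrable_smul_left_of_hasCompactSupport hφ hc

/-- The lemma of du Bois-Reymond. -/
lemma ae_eq_const_of_integral_deriv_mul_eq_zero {u : ℝ → ℝ} (hu : LocallyIntegrable u)
    (h : ∀ φ : ℝ → ℝ, ContDiff ℝ ∞ φ → HasCompactSupport φ → ∫ x, deriv φ x * u x = 0) :
    ∃ c, ∀ᵐ x, u x = c := by
  let β : ContDiffBump (0 : ℝ) := ⟨1, 2, one_pos, one_lt_two⟩
  set η : ℝ → ℝ := β.normed volume with hη
  have hη1 : ∫ x, η x = 1 := β.integral_normed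
  have hηs : ContDiff ℝ ∞ η := β.contDiff_normed
  have hηc : HasCompactSupport η := β.hasCompactSupport_normed
  refine ⟨∫ x, η x * u x, ae_eq_of_integral_contDiff_smul_eq hu
    continuous_const.locallyIntegrable fun ψ hψ hψc => ?_⟩
  simp only [smul_eq_mul]
  set m := ∫ x, ψ x with hm
  have hi := hψ.continuous.integrable_of_hasCompactSupport (μ := volume) hψc
  have hηi := hηs.continuous.integrable_of_hasCompactSupport (μ := volume) hηc
  -- Removing the multiple `m` of the normalised bump `η` makes the integral of `ψ` zero, so the
  -- remainder is the derivative of a test function.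
  obtain ⟨φ, hφ, hφc, hφd⟩ := exists_primitive_of_integral_eq_zero
    (θ := fun x => ψ x - m * η x) (hψ.sub (contDiff_const.mul hηs))
    (hψc.sub (hηc.mul_left (f := fun _ => m)))
    (by rw [integral_sub hi (hηi.const_mul m), integral_const_mul, hη1, mul_one, sub_self])
  have h1 := h φ hφ hφc
  rw [hφd] at h1
  have h2 : ∫ x, (ψ x - m * η x) * u x = (∫ x, ψ x * u x) - m * ∫ x, η x * u x := by
    rw [← integral_const_mul, ← integral_sub
      (integrable_mul_of_hasCompactSupport hψ.continuous hψc hu)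
      ((integrable_mul_of_hasCompactSupport hηs.continuous hηc hu).const_mul m)]
    exact integral_congr_ae (Eventually.of_forall fun x => by ring)
  rw [h2] at h1
  rw [integral_mul_const, ← hm]
  linarith

/-- A function with a weak derivative is almost everywhere a primitive of it. -/
lemma HasWeakDeriv.exists_ae_eq_primitive {u g : ℝ → ℝ} (h : HasWeakDeriv u g)
    (hu : LocallyIntegrable u) (hg : LocallyIntegrable g) :
    ∃ c, ∀ᵐ x, u x = c + ∫ t in (0 : ℝ)..x, g t := by
  have hv := continuous_primitive hg 0
  have hw : LocallyIntegrable fun x => u x - (0 + ∫ t in (0 : ℝ)..x, g t) :=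
    hu.sub hv.locallyIntegrable
  -- The primitive also has weak derivative `g`, by parts on an interval at whose end points `φ`
  -- vanishes; hence the difference has weak derivative zero.
  obtain ⟨c, hc⟩ := ae_eq_const_of_integral_deriv_mul_eq_zero hw fun φ hφ hφc => by
    have hd : Continuous (deriv φ) := hφ.continuous_deriv (by simp)
    obtain ⟨N, hN0, hN⟩ := exists_support_subset_Ioc hφc
    obtain ⟨N', hN0', hN'⟩ := exists_support_subset_Ioc hφc.deriv
    set L := max N N' with hL
    have hφL : ∀ x, L ≤ |x| → φ x = 0 := fun x hx => hN x ((le_max_left _ _).trans hx)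
    have hdL : ∀ x, L ≤ |x| → deriv φ x = 0 := fun x hx => hN' x ((le_max_right _ _).trans hx)
    have hL0 : 0 < L := hN0.trans_le (le_max_left _ _)
    have h1 := integral_deriv_mul_primitive hg 0 (-L) L
      ((hφ.of_le (by simp)).contDiffOn.absolutelyContinuousOnInterval)
    rw [hφL L (le_abs_self L), hφL (-L) (by rw [abs_neg]; exact le_abs_self L), zero_mul, zero_mul,
      sub_zero, integral_eq_of_vanish fun x hx => by rw [hφL x hx, hdL x hx, zero_mul, zero_mul,
      add_zero], integral_add
        (integrable_mul_of_hasCompactSupport hd hφc.deriv hv.locallyIntegrable)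
        (integrable_mul_of_hasCompactSupport hφ.continuous hφc hg)] at h1
    simp_rw [mul_sub]
    rw [integral_sub (integrable_mul_of_hasCompactSupport hd hφc.deriv hu)
      (integrable_mul_of_hasCompactSupport hd hφc.deriv hv.locallyIntegrable), h φ hφ hφc]
    linarith
  refine ⟨c, ?_⟩
  filter_upwards [hc] with x hx
  linarith

/-- Wirtinger's inequality for functions vanishing at the end points, below the optimal constant. -/
lemma sq_mul_integral_sq_le_of_lt {F F' : ℝ → ℝ} {a b k : ℝ} (hab : a < b)
    (hF : ∀ x, HasDerivAt F (F' x) x) (hF' : Continuous F') (ha : F a = 0) (hb : F b = 0)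
    (hk0 : 0 < k) (hk : k < Real.pi / (b - a)) :
    k ^ 2 * ∫ x in a..b, F x ^ 2 ≤ ∫ x in a..b, F' x ^ 2 := by
  have hFc : Continuous F := continuous_iff_continuousAt.mpr fun x => (hF x).continuousAt
  have hk' : k * (b - a) < Real.pi := by rwa [lt_div_iff₀ (by linarith)] at hk
  set m := (a + b) / 2 with hm
  -- `T` solves the Riccati equation `T' = -k² - T²`, so `(F' - T F)² ≥ 0` reads `(T F²)' ≤ F'² - k²
  -- F²`. Centring at the midpoint with `k < π/(b-a)` keeps the poles of the tangent off the closed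
  -- interval.
  set T : ℝ → ℝ := fun x => -(k * Real.tan (k * (x - m))) with hT
  have hTd : ∀ x ∈ Icc a b, HasDerivAt T (-k ^ 2 - T x ^ 2) x := by
    intro x hx
    have h1 : -(Real.pi / 2) < k * (x - m) := by rw [hm]; nlinarith [hx.1]
    have h2 : k * (x - m) < Real.pi / 2 := by rw [hm]; nlinarith [hx.2]
    have hcos := Real.cos_pos_of_mem_Ioo ⟨h1, h2⟩
    have h3 : HasDerivAt (fun x : ℝ => k * (x - m)) k x := by
      simpa using ((hasDerivAt_id x).sub_const m).const_mul k
    have h4 := ((((Real.hasDerivAt_tan hcos.ne').comp x h3)).const_mul k).neg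
    refine h4.congr_deriv ?_
    simp only [hT]
    rw [← Real.inv_one_add_tan_sq hcos.ne']
    have : (0 : ℝ) < 1 + Real.tan (k * (x - m)) ^ 2 := by positivity
    field_simp
    ring
  have hTc : ContinuousOn T (Icc a b) := fun x hx => (hTd x hx).continuousAt.continuousWithinAt
  have hW : ∀ x ∈ uIcc a b, HasDerivAt (fun x => T x * F x ^ 2)
      ((-k ^ 2 - T x ^ 2) * F x ^ 2 + T x * (2 * F x * F' x)) x := by
    intro x hx
    rw [uIcc_of_le hab.le] at hx
    refine ((hTd x hx).mul ((hF x).pow 2)).congr_deriv ?_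
    simp
  have hWi : IntervalIntegrable (fun x => (-k ^ 2 - T x ^ 2) * F x ^ 2 + T x * (2 * F x * F' x))
      volume a b := by
    refine ContinuousOn.intervalIntegrable ?_
    rw [uIcc_of_le hab.le]
    fun_prop
  have hint := intervalIntegral.integral_eq_sub_of_hasDerivAt hW hWi
  rw [ha, hb] at hint
  have hle : ∫ x in a..b, ((-k ^ 2 - T x ^ 2) * F x ^ 2 + T x * (2 * F x * F' x)) ≤
      ∫ x in a..b, (F' x ^ 2 - k ^ 2 * F x ^ 2) := by
    refine intervalIntegral.integral_mono_on hab.le hWi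
      (Continuous.intervalIntegrable (by fun_prop) a b) fun x _ => ?_
    nlinarith [sq_nonneg (F' x - T x * F x)]
  rw [hint, intervalIntegral.integral_sub (Continuous.intervalIntegrable (by fun_prop) a b)
    (Continuous.intervalIntegrable (by fun_prop) a b), intervalIntegral.integral_const_mul] at hle
  linarith

/-- Wirtinger's inequality for functions vanishing at the end points. -/
lemma sq_mul_integral_sq_le {F F' : ℝ → ℝ} {a b : ℝ} (hab : a < b)
    (hF : ∀ x, HasDerivAt F (F' x) x) (hF' : Continuous F') (ha : F a = 0) (hb : F b = 0) :
    (Real.pi / (b - a)) ^ 2 * ∫ x in a..b, F x ^ 2 ≤ ∫ x in a..b, F' x ^ 2 := by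
  have hK : 0 < Real.pi / (b - a) := div_pos Real.pi_pos (by linarith)
  have h : Tendsto (fun k : ℝ => k ^ 2 * ∫ x in a..b, F x ^ 2) (𝓝[<] (Real.pi / (b - a)))
      (𝓝 ((Real.pi / (b - a)) ^ 2 * ∫ x in a..b, F x ^ 2)) :=
    ((by fun_prop : Continuous fun k : ℝ => k ^ 2 * ∫ x in a..b, F x ^ 2).tendsto _).mono_left
      nhdsWithin_le_nhds
  refine le_of_tendsto h ?_
  filter_upwards [Ioo_mem_nhdsLT hK] with k hk
  exact sq_mul_integral_sq_le_of_lt hab hF hF' ha hb hk.1 hk.2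

/-- The Poincaré–Wirtinger inequality on an interval, for primitives. -/
lemma integral_sq_primitive_le {g : ℝ → ℝ} (hg : LocallyIntegrable g)
    (hg2 : LocallyIntegrable fun x => g x ^ 2) (c : ℝ) {a b : ℝ} (hab : a < b) :
    ∫ x in a..b, (c + ∫ t in (0 : ℝ)..x, g t) ^ 2 ≤
      (∫ x in a..b, (c + ∫ t in (0 : ℝ)..x, g t)) ^ 2 / (b - a) +
        ((b - a) / Real.pi) ^ 2 * ∫ x in a..b, g x ^ 2 := by
  have hba : 0 < b - a := by linarith
  set u : ℝ → ℝ := fun x => c + ∫ t in (0 : ℝ)..x, g t with hu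
  have huc : Continuous u := continuous_primitive hg c
  set m := (∫ x in a..b, u x) / (b - a) with hm
  -- `F` vanishes at both ends, so the case of mean zero reduces to the Dirichlet case: by parts, `∫
  -- (u - m)² = -∫ F g`.
  set F : ℝ → ℝ := fun x => ∫ t in a..x, (u t - m) with hFdef
  have hF'c : Continuous fun t => u t - m := by fun_prop
  have hF : ∀ x, HasDerivAt F (u x - m) x := fun x =>
    (hF'c.integral_hasStrictDerivAt a x).hasDerivAt
  have hFc : Continuous F := continuous_iff_continuousAt.mpr fun x => (hF x).continuousAt
  have hFa : F a = 0 := intervalIntegral.integral_same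
  have hFb : F b = 0 := by
    simp only [hFdef]
    rw [intervalIntegral.integral_sub (huc.intervalIntegrable a b) intervalIntegrable_const,
      intervalIntegral.integral_const, hm, smul_eq_mul, mul_div_cancel₀ _ hba.ne', sub_self]
  have hFd : deriv F = fun x => u x - m := funext fun x => (hF x).deriv
  have hFs : ContDiff ℝ 1 F := by
    rw [contDiff_one_iff_deriv, hFd]
    exact ⟨fun x => (hF x).differentiableAt, hF'c⟩
  have hibp := integral_deriv_mul_primitive hg (c - m) a b
    hFs.contDiffOn.absolutelyContinuousOnInterval
  rw [hFa, hFb, hFd] at hibp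
  have hum : ∀ x, c - m + ∫ t in (0 : ℝ)..x, g t = u x - m := fun x => by simp only [hu]; ring
  simp only [hum, zero_mul, sub_zero] at hibp
  have hgi : IntervalIntegrable g volume a b := intervalIntegrable_of_locallyIntegrable hg a b
  have hFg : IntervalIntegrable (fun x => F x * g x) volume a b := hgi.continuousOn_mul hFc.continuousOn
  have hg2i : IntervalIntegrable (fun x => g x ^ 2) volume a b := intervalIntegrable_of_locallyIntegrable hg2 a b
  have hDi : IntervalIntegrable (fun x => (u x - m) * (u x - m)) volume a b :=
    Continuous.intervalIntegrable (by fun_prop) a b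
  rw [intervalIntegral.integral_add hDi hFg] at hibp
  have hwirt := sq_mul_integral_sq_le hab hF hF'c hFa hFb
  set K := Real.pi / (b - a) with hKdef
  have hK : 0 < K := div_pos Real.pi_pos hba
  have hD : ∫ x in a..b, (u x - m) ^ 2 = ∫ x in a..b, (u x - m) * (u x - m) := by
    simp_rw [sq]
  -- With these weights Wirtinger's inequality bounds the `F²` term by half of `∫ (u - m)²`, which
  -- is absorbed on the left.
  have hamgm : ∫ x in a..b, -(F x * g x) ≤
      ∫ x in a..b, (K ^ 2 / 2 * F x ^ 2 + (2 * K ^ 2)⁻¹ * g x ^ 2) := by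
    refine intervalIntegral.integral_mono_on hab.le hFg.neg
      ((Continuous.intervalIntegrable (by fun_prop) a b).add (hg2i.const_mul _)) fun x _ => ?_
    have h1 : K ^ 2 / 2 * F x ^ 2 + (2 * K ^ 2)⁻¹ * g x ^ 2 + F x * g x =
        (K * F x + K⁻¹ * g x) ^ 2 / 2 := by field_simp; ring
    nlinarith [sq_nonneg (K * F x + K⁻¹ * g x)]
  rw [intervalIntegral.integral_neg, intervalIntegral.integral_add
    (Continuous.intervalIntegrable (by fun_prop) a b) (hg2i.const_mul _),
    intervalIntegral.integral_const_mul, intervalIntegral.integral_const_mul] at hamgm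
  have hKinv : ((b - a) / Real.pi) ^ 2 = 2 * (2 * K ^ 2)⁻¹ := by
    rw [hKdef]; have := Real.pi_pos; field_simp
  have hexp : ∫ x in a..b, (u x - m) ^ 2 =
      (∫ x in a..b, u x ^ 2) - (∫ x in a..b, u x) ^ 2 / (b - a) := by
    have h1 : ∀ x, (u x - m) ^ 2 = u x ^ 2 - (2 * m * u x - m ^ 2) := fun x => by ring
    simp_rw [h1]
    rw [intervalIntegral.integral_sub (Continuous.intervalIntegrable (by fun_prop) a b)
      (Continuous.intervalIntegrable (by fun_prop) a b), intervalIntegral.integral_sub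
      (Continuous.intervalIntegrable (by fun_prop) a b) intervalIntegrable_const,
      intervalIntegral.integral_const_mul, intervalIntegral.integral_const, smul_eq_mul, hm]
    field_simp
    ring
  rw [hKinv]
  linarith

/-- The integrand is the derivative of `x u²`, whose boundary contribution `R (u(R)² + u(-R)²)` is
nonnegative. Only its sign is used, so no decay of `u` has to be proved when `R → ∞`. -/
lemma integral_sq_add_two_mul_primitive_nonneg {g : ℝ → ℝ} (hg : LocallyIntegrable g) (c : ℝ)
    {R : ℝ} (hR : 0 ≤ R) :
    0 ≤ ∫ x in (-R)..R, ((c + ∫ t in (0 : ℝ)..x, g t) ^ 2 +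
      2 * (x * (c + ∫ t in (0 : ℝ)..x, g t) * g x)) := by
  have hac := absolutelyContinuousOnInterval_primitive hg c (-R) R
  set u : ℝ → ℝ := fun x => c + ∫ t in (0 : ℝ)..x, g t with hu
  have hid : AbsolutelyContinuousOnInterval (fun x : ℝ => x) (-R) R :=
    contDiff_id.contDiffOn.absolutelyContinuousOnInterval
  have h := hid.integral_deriv_mul_eq_sub (hac.fun_mul hac)
  have h2 : ∫ x in (-R)..R, (u x ^ 2 + 2 * (x * u x * g x)) =
      ∫ x in (-R)..R, (deriv (fun x : ℝ => x) x * (u x * u x) +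
        x * deriv (fun x => u x * u x) x) := by
    refine intervalIntegral.integral_congr_ae ?_
    filter_upwards [ae_hasDerivAt_primitive hg c] with x hx _
    have hx' : HasDerivAt (fun x => u x * u x) _ x := hx.mul hx
    rw [hx'.deriv, deriv_id'']
    ring
  rw [h2, h]
  nlinarith [mul_nonneg hR (mul_self_nonneg (u R)), mul_nonneg hR (mul_self_nonneg (u (-R)))]

lemma locallyIntegrable_of_memLp_two {u : ℝ → ℝ} (hu : MemLp u 2 volume) : LocallyIntegrable u :=
  hu.locallyIntegrable (by norm_num)

/-- The Poincaré–Wirtinger inequality, with the optimal constant. -/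
theorem HasWeakDeriv.integral_sq_le {u g : ℝ → ℝ} (h : HasWeakDeriv u g) (hu : MemLp u 2 volume)
    (hg : MemLp g 2 volume) {a b : ℝ} (hab : a < b) :
    ∫ x in a..b, u x ^ 2 ≤
      (∫ x in a..b, u x) ^ 2 / (b - a) + ((b - a) / Real.pi) ^ 2 * ∫ x in a..b, g x ^ 2 := by
  obtain ⟨c, hc⟩ := h.exists_ae_eq_primitive (locallyIntegrable_of_memLp_two hu)
    (locallyIntegrable_of_memLp_two hg)
  rw [intervalIntegral.integral_congr_ae (g := fun x => c + ∫ t in (0 : ℝ)..x, g t)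
      (hc.mono fun x hx _ => hx),
    intervalIntegral.integral_congr_ae (g := fun x => (c + ∫ t in (0 : ℝ)..x, g t) ^ 2)
      (hc.mono fun x hx _ => by rw [hx])]
  exact integral_sq_primitive_le (locallyIntegrable_of_memLp_two hg)
    hg.integrable_sq.locallyIntegrable c hab

/-- The half of the canonical commutation relation that follows without boundary terms. -/
theorem HasWeakDeriv.integral_sq_add_nonneg {u g : ℝ → ℝ} (h : HasWeakDeriv u g)
    (hu : MemLp u 2 volume) (hg : MemLp g 2 volume) (hxu : MemLp (fun x => x * u x) 2 volume) :
    0 ≤ ∫ x, (u x ^ 2 + 2 * (x * u x * g x)) := by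
  obtain ⟨c, hc⟩ := h.exists_ae_eq_primitive (locallyIntegrable_of_memLp_two hu)
    (locallyIntegrable_of_memLp_two hg)
  have hi : Integrable fun x => u x ^ 2 + 2 * (x * u x * g x) :=
    hu.integrable_sq.add ((hxu.integrable_mul hg).const_mul 2)
  have ht := intervalIntegral_tendsto_integral hi tendsto_neg_atTop_atBot tendsto_id
  refine ge_of_tendsto ht ?_
  filter_upwards [eventually_ge_atTop 0] with R hR
  refine (integral_sq_add_two_mul_primitive_nonneg (locallyIntegrable_of_memLp_two hg) c hR).trans_eq
    (intervalIntegral.integral_congr_ae ?_)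
  filter_upwards [hc] with x hx _
  rw [hx]

end Sobolev


/-! ### Wave functions, photon number and the box projection -/

section Modes

open Set Filter Topology

lemma integral_complex_re {α : Type*} [MeasurableSpace α] {μ : Measure α} {f : α → ℂ}
    (hf : Integrable f μ) : ∫ x, (f x).re ∂μ = (∫ x, f x ∂μ).re :=
  integral_re hf

lemma integral_complex_im {α : Type*} [MeasurableSpace α] {μ : Measure α} {f : α → ℂ}
    (hf : Integrable f μ) : ∫ x, (f x).im ∂μ = (∫ x, f x ∂μ).im :=
  integral_im hf

lemma complex_norm_sq (z : ℂ) : ‖z‖ ^ 2 = z.re ^ 2 + z.im ^ 2 := by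
  rw [Complex.sq_norm, Complex.normSq_apply]; ring

lemma memLp_re (f : Mode) : MemLp (fun x => (f x).re) 2 volume := (Lp.memLp f).re

lemma memLp_im (f : Mode) : MemLp (fun x => (f x).im) 2 volume := (Lp.memLp f).im

lemma integrable_norm_sq (f : Mode) : Integrable fun x => ‖f x‖ ^ 2 :=
  (memLp_two_iff_integrable_sq_norm (Lp.memLp f).1).mp (Lp.memLp f)

lemma norm_sq_eq_integral (f : Mode) : ‖f‖ ^ 2 = ∫ x, ‖f x‖ ^ 2 := by
  rw [← inner_self_eq_norm_sq (𝕜 := ℂ), L2.inner_def, ← integral_re (L2.integrable_inner f f)]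
  exact integral_congr_ae (Eventually.of_forall fun x => inner_self_eq_norm_sq _)

/-- The weak derivative of `f` is `i g`, with real part `-Im g` and imaginary part `Re g`. -/
lemma hasWeakDeriv_re {f g : Mode} (h : (f, g) ∈ pGraph) :
    HasWeakDeriv (fun x => (f x).re) fun x => -(g x).im := by
  intro φ hφ hc
  have hd : Continuous (deriv φ) := hφ.continuous_deriv (by simp)
  have hi : Integrable fun x => (φ x : ℂ) * (Complex.I * g x) :=
    ((integrable_test_mul hφ.continuous hc g).const_mul Complex.I).congr
      (Eventually.of_forall fun x => by simp only []; ring)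
  have h1 := congrArg Complex.re (h φ hφ hc)
  rw [Complex.neg_re, ← integral_complex_re (integrable_test_mul hd hc.deriv f),
    ← integral_complex_re hi] at h1
  simpa using h1

lemma hasWeakDeriv_im {f g : Mode} (h : (f, g) ∈ pGraph) :
    HasWeakDeriv (fun x => (f x).im) fun x => (g x).re := by
  intro φ hφ hc
  have hd : Continuous (deriv φ) := hφ.continuous_deriv (by simp)
  have hi : Integrable fun x => (φ x : ℂ) * (Complex.I * g x) :=
    ((integrable_test_mul hφ.continuous hc g).const_mul Complex.I).congr
      (Eventually.of_forall fun x => by simp only []; ring)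
  have h1 := congrArg Complex.im (h φ hφ hc)
  rw [Complex.neg_im, ← integral_complex_im (integrable_test_mul hd hc.deriv f),
    ← integral_complex_im hi] at h1
  simpa using h1

lemma integrable_restrict_mode (f : Mode) (a b : ℝ) : IntegrableOn (f : ℝ → ℂ) (Ioc a b) :=
  integrableOn_Lp_of_measure_ne_top f (by norm_num) measure_Ioc_lt_top.ne

/-- The Poincaré–Wirtinger inequality for the wave function of a state with finite momentum
variance. -/
lemma integral_norm_sq_le_of_mem_pGraph {f g : Mode} (h : (f, g) ∈ pGraph) {a b : ℝ} (hab : a < b) :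
    ∫ x in a..b, ‖f x‖ ^ 2 ≤ ‖∫ x in a..b, f x‖ ^ 2 / (b - a) +
      ((b - a) / Real.pi) ^ 2 * ∫ x in a..b, ‖g x‖ ^ 2 := by
  have hii : ∀ u : ℝ → ℝ, MemLp u 2 volume → IntervalIntegrable (fun x => u x ^ 2) volume a b :=
    fun u hu => hu.integrable_sq.intervalIntegrable
  have h1 := (hasWeakDeriv_re h).integral_sq_le (memLp_re f) (memLp_im g).neg hab
  have h2 := (hasWeakDeriv_im h).integral_sq_le (memLp_im f) (memLp_re g) hab
  have hre : ∫ x in a..b, (f x).re = (∫ x in a..b, f x).re := by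
    rw [intervalIntegral.integral_of_le hab.le, intervalIntegral.integral_of_le hab.le]
    exact integral_complex_re (integrable_restrict_mode f a b)
  have him : ∫ x in a..b, (f x).im = (∫ x in a..b, f x).im := by
    rw [intervalIntegral.integral_of_le hab.le, intervalIntegral.integral_of_le hab.le]
    exact integral_complex_im (integrable_restrict_mode f a b)
  simp only [complex_norm_sq, neg_sq] at h1 h2 ⊢
  rw [intervalIntegral.integral_add (hii _ (memLp_re f)) (hii _ (memLp_im f)),
    intervalIntegral.integral_add (hii _ (memLp_re g)) (hii _ (memLp_im g)), ← hre, ← him, add_div]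
  linarith

lemma pOp_mem_pGraph (f : pOp.domain) : ((f : Mode), pOp f) ∈ pGraph := by
  rw [← pOp_graph]
  exact pOp.mem_graph f

lemma coe_mulOp_ae (k : ℝ → ℂ) (f : (mulOp k).domain) :
    ∀ᵐ x, (mulOp k f : Mode) x = k x * (f : Mode) x :=
  MemLp.coeFn_toLp f.2

/-- `‖p̂ ψ‖² ≤ 2 ‖â ψ‖² + ‖ψ‖²`. -/
lemma norm_sq_pOp_le (f : Mode) (ha : f ∈ annihilation.domain) (hp : f ∈ pOp.domain) :
    ‖pOp ⟨f, hp⟩‖ ^ 2 ≤ 2 * ‖annihilation ⟨f, ha⟩‖ ^ 2 + ‖f‖ ^ 2 := by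
  have hq : f ∈ qOp.domain := ha.1
  set Q := qOp ⟨f, hq⟩ with hQ
  set P := pOp ⟨f, hp⟩ with hP
  have hann : annihilation ⟨f, ha⟩ = ((1 / Real.sqrt 2 : ℝ) : ℂ) • (Q + Complex.I • P) := rfl
  have hPg : (f, P) ∈ pGraph := pOp_mem_pGraph ⟨f, hp⟩
  have hQae : ∀ᵐ x, Q x = (x : ℂ) * f x := coe_mulOp_ae _ ⟨f, hq⟩
  have hre := (hasWeakDeriv_re hPg).integral_sq_add_nonneg (memLp_re f) (memLp_im P).neg
    ((memLp_congr_ae (hQae.mono fun x hx => by simp [hx])).mp (memLp_re Q))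
  have him := (hasWeakDeriv_im hPg).integral_sq_add_nonneg (memLp_im f) (memLp_re P)
    ((memLp_congr_ae (hQae.mono fun x hx => by simp [hx])).mp (memLp_im Q))
  have hi1 : Integrable fun x => (Q x).re * -(P x).im := (memLp_re Q).integrable_mul (memLp_im P).neg
  have hi2 : Integrable fun x => (Q x).im * (P x).re := (memLp_im Q).integrable_mul (memLp_re P)
  have hinner : (inner ℂ Q (Complex.I • P)).re =
      (∫ x, (Q x).re * -(P x).im) + ∫ x, (Q x).im * (P x).re := by
    rw [L2.inner_def, ← integral_complex_re (L2.integrable_inner Q (Complex.I • P)),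
      ← integral_add hi1 hi2]
    refine integral_congr_ae ?_
    filter_upwards [coe_smul_ae Complex.I P] with x hx
    rw [hx, RCLike.inner_apply]
    simp
    ring
  have e1 : ∫ x, ((f x).re ^ 2 + 2 * (x * (f x).re * -(P x).im)) =
      (∫ x, (f x).re ^ 2) + 2 * ∫ x, (Q x).re * -(P x).im := by
    rw [← integral_const_mul, ← integral_add (memLp_re f).integrable_sq (hi1.const_mul 2)]
    refine integral_congr_ae (hQae.mono fun x hx => ?_)
    simp [hx]
  have e2 : ∫ x, ((f x).im ^ 2 + 2 * (x * (f x).im * (P x).re)) =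
      (∫ x, (f x).im ^ 2) + 2 * ∫ x, (Q x).im * (P x).re := by
    rw [← integral_const_mul, ← integral_add (memLp_im f).integrable_sq (hi2.const_mul 2)]
    refine integral_congr_ae (hQae.mono fun x hx => ?_)
    simp [hx]
  have hf : ‖f‖ ^ 2 = (∫ x, (f x).re ^ 2) + ∫ x, (f x).im ^ 2 := by
    rw [norm_sq_eq_integral, ← integral_add (memLp_re f).integrable_sq (memLp_im f).integrable_sq]
    simp_rw [complex_norm_sq]
  have hnorm : ‖annihilation ⟨f, ha⟩‖ ^ 2 = (‖Q + Complex.I • P‖ ^ 2) / 2 := by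
    rw [hann, norm_smul, mul_pow, Complex.norm_real, Real.norm_eq_abs, sq_abs, div_pow,
      Real.sq_sqrt (by norm_num)]
    ring
  rw [e1] at hre
  rw [e2] at him
  rw [hnorm, @norm_add_sq ℂ, norm_smul, Complex.norm_I, one_mul]
  change _ ≤ 2 * ((‖Q‖ ^ 2 + 2 * (inner ℂ Q (Complex.I • P)).re + ‖P‖ ^ 2) / 2) + ‖f‖ ^ 2
  rw [hinner]
  -- `hre` and `him` add up to `‖f‖² + 2 Re⟨Q, iP⟩ ≥ 0`; the term `‖Q‖²` is then dropped.
  nlinarith [sq_nonneg ‖Q‖]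

/-- The pointwise bound summed over `√ρ eₙ`. A vector outside the domain of `â` makes the right side
infinite; otherwise it lies in the domain of `p̂`. -/
lemma momentumSq_le (ρ : Mode →L[ℂ] Mode) :
    momentumSq ρ ≤ 2 * meanPhotonNumber ρ + hsSq (sqrtOp ρ) := by
  unfold momentumSq meanPhotonNumber hsSq
  rw [expectAdjMul_eq_tsum, expectAdjMul_eq_tsum, ← ENNReal.tsum_mul_left, ← ENNReal.tsum_add]
  refine ENNReal.tsum_le_tsum fun n => ?_
  set ψ := sqrtOp ρ (basis Mode n)
  by_cases ha : ψ ∈ annihilation.domain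
  · have hp : ψ ∈ pOp.domain := ha.2
    rw [dif_pos ha, dif_pos hp, ← ofReal_norm_sq, ← ofReal_norm_sq, ← ofReal_norm_sq,
      show (2 : ℝ≥0∞) * _ = ENNReal.ofReal 2 * _ by rw [ENNReal.ofReal_ofNat],
      ← ENNReal.ofReal_mul (by norm_num), ← ENNReal.ofReal_add (by positivity) (by positivity)]
    exact ENNReal.ofReal_le_ofReal (norm_sq_pOp_le ψ ha hp)
  · rw [dif_neg ha, ENNReal.mul_top (by norm_num), top_add]
    exact le_top

/-! ### Boxes -/

lemma boxWidth_pos {d : ℕ} (hd : 0 < d) : 0 < boxWidth d :=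
  Real.sqrt_pos.mpr (by have := Real.pi_pos; positivity)

lemma boxWidth_sq {d : ℕ} : boxWidth d ^ 2 = 2 * Real.pi / d :=
  Real.sq_sqrt (by have := Real.pi_pos; positivity)

lemma qMax_eq_mul_boxWidth {m : ℕ} (hm : 0 < m) : qMax (m + m) = m * boxWidth (m + m) := by
  have hm' : (0 : ℝ) < m := Nat.cast_pos.mpr hm
  have h : Real.pi * (m + m : ℕ) / 2 = (m : ℝ) ^ 2 * (2 * Real.pi / (m + m : ℕ)) := by
    push_cast
    field_simp
    ring
  rw [qMax, boxWidth, h, Real.sqrt_mul (sq_nonneg _), Real.sqrt_sq hm'.le]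

lemma inner_boxKet (d : ℕ) (i : ℤ) (f : Mode) :
    inner ℂ (boxKet d i) f = ((1 / Real.sqrt (boxWidth d) : ℝ) : ℂ) *
      ∫ x in (i * boxWidth d)..((i + 1) * boxWidth d), f x := by
  have hle : i * boxWidth d ≤ (i + 1) * boxWidth d := by
    have : 0 ≤ boxWidth d := Real.sqrt_nonneg _
    linarith
  rw [boxKet, L2.inner_indicatorConstLp_eq_inner_setIntegral, RCLike.inner_apply,
    Complex.conj_ofReal, mul_comm, intervalIntegral.integral_of_le hle, integral_Ico_eq_integral_Ioc]

lemma orthonormal_boxKet {d : ℕ} (hd : 0 < d) : Orthonormal ℂ (boxKet d) := by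
  have hw := boxWidth_pos hd
  rw [orthonormal_iff_ite]
  intro i j
  rw [boxKet, boxKet, L2.inner_indicatorConstLp_indicatorConstLp _ _ measure_Ico_lt_top.ne
    measure_Ico_lt_top.ne]
  split_ifs with hij
  · subst hij
    rw [inter_self, measureReal_def, Real.volume_Ico, ENNReal.toReal_ofReal (by linarith),
      RCLike.inner_apply, Complex.conj_ofReal]
    rw [Complex.real_smul]
    norm_cast
    rw [← sq, div_pow, Real.sq_sqrt hw.le]
    field_simp
    push_cast
    ring
  · have hdisj : Ico (i * boxWidth d) ((i + 1) * boxWidth d) ∩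
        Ico (j * boxWidth d) ((j + 1) * boxWidth d) = ∅ := by
      rw [eq_empty_iff_forall_notMem]
      rintro x ⟨⟨h1, h2⟩, h3, h4⟩
      have h5 := lt_of_mul_lt_mul_right (h1.trans_lt h4) hw.le
      have h6 := lt_of_mul_lt_mul_right (h3.trans_lt h2) hw.le
      norm_cast at h5 h6
      omega
    rw [hdisj, measureReal_empty, zero_smul]

lemma boxProj_apply (d : ℕ) (f : Mode) :
    boxProj d f = ∑ i ∈ Finset.Ico (-((d : ℤ) / 2)) ((d : ℤ) / 2),
      inner ℂ (boxKet d i) f • boxKet d i := by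
  simp [boxProj]

lemma adjoint_boxProj (d : ℕ) : ContinuousLinearMap.adjoint (boxProj d) = boxProj d := by
  simp [boxProj, map_sum]

lemma boxProj_comp_boxProj {d : ℕ} (hd : 0 < d) : boxProj d ∘L boxProj d = boxProj d := by
  ext1 f
  rw [ContinuousLinearMap.comp_apply, boxProj_apply d (boxProj d f)]
  conv_rhs => rw [boxProj_apply]
  refine Finset.sum_congr rfl fun i hi => ?_
  rw [boxProj_apply, (orthonormal_boxKet hd).inner_right_sum _ hi]

lemma norm_sq_boxProj {d : ℕ} (hd : 0 < d) (f : Mode) :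
    ‖boxProj d f‖ ^ 2 = ∑ i ∈ Finset.Ico (-((d : ℤ) / 2)) ((d : ℤ) / 2),
      ‖∫ x in (i * boxWidth d)..((i + 1) * boxWidth d), f x‖ ^ 2 / boxWidth d := by
  have hw := boxWidth_pos hd
  have h1 : inner ℂ (boxProj d f) (boxProj d f) = (∑ i ∈ Finset.Ico (-((d : ℤ) / 2)) ((d : ℤ) / 2),
      (‖inner ℂ (boxKet d i) f‖ ^ 2 : ℝ) : ℂ) := by
    rw [boxProj_apply, (orthonormal_boxKet hd).inner_sum]
    push_cast
    exact Finset.sum_congr rfl fun i _ => Complex.conj_mul' _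
  rw [inner_self_eq_norm_sq_to_K] at h1
  have h2 : ‖boxProj d f‖ ^ 2 = ∑ i ∈ Finset.Ico (-((d : ℤ) / 2)) ((d : ℤ) / 2),
      ‖inner ℂ (boxKet d i) f‖ ^ 2 := by
    exact Complex.ofReal_injective (by push_cast at h1 ⊢; exact h1)
  rw [h2]
  refine Finset.sum_congr rfl fun i _ => ?_
  rw [inner_boxKet, norm_mul, mul_pow, Complex.norm_real, Real.norm_eq_abs, sq_abs, div_pow,
    Real.sq_sqrt hw.le]
  ring

lemma norm_sq_qProj {S : Set ℝ} (hS : MeasurableSet S) (f : (qProj S).domain) :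
    ‖qProj S f‖ ^ 2 = ∫ x in S, ‖(f : Mode) x‖ ^ 2 := by
  rw [norm_sq_eq_integral, ← integral_indicator hS]
  refine integral_congr_ae ((coe_mulOp_ae _ f).mono fun x hx => ?_)
  simp only []
  rw [show (qProj S f : Mode) x = _ from hx]
  by_cases h : x ∈ S <;> simp [h]

lemma mem_domain_qProj {S : Set ℝ} (hS : MeasurableSet S) (f : Mode) : f ∈ (qProj S).domain := by
  refine (memLp_congr_ae (Eventually.of_forall fun x => ?_)).mp ((Lp.memLp f).indicator hS)
  by_cases h : x ∈ S <;> simp [h]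

/-- Poincaré–Wirtinger on each box: the squared means add up to `‖Πf‖²`, and `(Δ/π)² = 2/(πd)`.
Evenness of `d` makes the boxes tile the window up to `±q_max`. -/
lemma norm_sq_le_of_mem_pGraph {d : ℕ} (hd : 0 < d) (hd2 : Even d) {f g : Mode}
    (h : (f, g) ∈ pGraph) :
    ‖f‖ ^ 2 ≤ ‖boxProj d f‖ ^ 2 + (∫ x in {q | qMax d ≤ |q|}, ‖f x‖ ^ 2) +
      2 / Real.pi * (‖g‖ ^ 2 / d) := by
  obtain ⟨m, rfl⟩ := hd2
  have hm : 0 < m := by omega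
  have hw := boxWidth_pos hd
  have hQ := qMax_eq_mul_boxWidth hm
  have hQ0 : 0 ≤ qMax (m + m) := Real.sqrt_nonneg _
  set w := boxWidth (m + m) with hwdef
  set Q := qMax (m + m) with hQdef
  set a : ℕ → ℝ := fun k => ((k : ℝ) - m) * w with ha
  have hlt : ∀ k, a k < a (k + 1) := fun k => by simp only [ha]; push_cast; linarith
  have hdiff : ∀ k, a (k + 1) - a k = w := fun k => by simp only [ha]; push_cast; ring
  have ha0 : a 0 = -Q := by simp only [ha]; rw [hQ]; push_cast; ring
  have had : a (m + m) = Q := by simp only [ha]; rw [hQ]; push_cast; ring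
  have hint : ∀ (u : Mode) (x y : ℝ), IntervalIntegrable (fun x => ‖u x‖ ^ 2) volume x y :=
    fun u x y => (integrable_norm_sq u).intervalIntegrable
  have hsum : ∀ u : Mode, ∑ k ∈ Finset.range (m + m), ∫ x in a k..a (k + 1), ‖u x‖ ^ 2 =
      ∫ x in (-Q)..Q, ‖u x‖ ^ 2 := fun u => by
    rw [intervalIntegral.sum_integral_adjacent_intervals fun k _ => hint u _ _, ha0, had]
  have hS : MeasurableSet {q : ℝ | Q ≤ |q|} := measurableSet_le measurable_const measurable_id.abs
  have hcompl : {q : ℝ | Q ≤ |q|}ᶜ = Ioo (-Q) Q := by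
    ext x
    simp [abs_lt]
  have hsplit : ‖f‖ ^ 2 = (∫ x in {q | Q ≤ |q|}, ‖f x‖ ^ 2) + ∫ x in (-Q)..Q, ‖f x‖ ^ 2 := by
    rw [norm_sq_eq_integral, ← integral_add_compl hS (integrable_norm_sq f), hcompl,
      intervalIntegral.integral_of_le (by linarith), integral_Ioc_eq_integral_Ioo]
  have hg : ∫ x in (-Q)..Q, ‖g x‖ ^ 2 ≤ ‖g‖ ^ 2 := by
    rw [norm_sq_eq_integral, intervalIntegral.integral_of_le (by linarith)]
    exact setIntegral_le_integral (integrable_norm_sq g) (Eventually.of_forall fun x => by positivity)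
  have hbox : ‖boxProj (m + m) f‖ ^ 2 =
      ∑ k ∈ Finset.range (m + m), ‖∫ x in a k..a (k + 1), f x‖ ^ 2 / w := by
    rw [norm_sq_boxProj hd, ← hwdef]
    have hm2 : ((m + m : ℕ) : ℤ) / 2 = m := by omega
    rw [hm2]
    -- Box `i` of the symmetric integer range becomes cell `k = i + m` of the partition that starts
    -- at `-Q`.
    refine Finset.sum_nbij' (fun i => (i + m).toNat) (fun k => (k : ℤ) - m) ?_ ?_ ?_ ?_ ?_
    · intro i hi
      rw [Finset.mem_Ico] at hi
      rw [Finset.mem_range]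
      omega
    · intro k hk
      rw [Finset.mem_range] at hk
      rw [Finset.mem_Ico]
      omega
    · intro i hi
      rw [Finset.mem_Ico] at hi
      omega
    · intro k hk
      omega
    · intro i hi
      rw [Finset.mem_Ico] at hi
      have hk : (((i + m).toNat : ℕ) : ℝ) = (i : ℝ) + m := by
        have : (((i + m).toNat : ℕ) : ℤ) = i + m := Int.toNat_of_nonneg (by omega)
        exact_mod_cast congrArg (Int.cast : ℤ → ℝ) this
      have e1 : a (i + m).toNat = i * w := by simp only [ha, hk]; ring
      have e2 : a ((i + m).toNat + 1) = (i + 1) * w := by simp only [ha]; push_cast; rw [hk]; ring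
      rw [e1, e2]
  have hpoinc : ∫ x in (-Q)..Q, ‖f x‖ ^ 2 ≤
      ‖boxProj (m + m) f‖ ^ 2 + (w / Real.pi) ^ 2 * ∫ x in (-Q)..Q, ‖g x‖ ^ 2 := by
    rw [← hsum f, ← hsum g, hbox, Finset.mul_sum, ← Finset.sum_add_distrib]
    refine Finset.sum_le_sum fun k _ => ?_
    have := integral_norm_sq_le_of_mem_pGraph h (hlt k)
    rwa [hdiff] at this
  have hcoef : (w / Real.pi) ^ 2 * ‖g‖ ^ 2 = 2 / Real.pi * (‖g‖ ^ 2 / (m + m : ℕ)) := by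
    rw [div_pow, hwdef, boxWidth_sq]
    have := Real.pi_pos
    have : ((m + m : ℕ) : ℝ) ≠ 0 := by exact_mod_cast hd.ne'
    field_simp
  rw [← hcoef, hsplit]
  have := mul_le_mul_of_nonneg_left hg (sq_nonneg (w / Real.pi))
  linarith

lemma hsSq_sqrtOp_le {d : ℕ} (hd : 0 < d) (hd2 : Even d) (ρ : Mode →L[ℂ] Mode) :
    hsSq (sqrtOp ρ) ≤ hsSq (boxProj d ∘L sqrtOp ρ) + (qProb ρ {q | qMax d ≤ |q|} +
      ENNReal.ofReal (2 / Real.pi) * (momentumSq ρ / d)) := by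
  have hS : MeasurableSet {q : ℝ | qMax d ≤ |q|} :=
    measurableSet_le measurable_const measurable_id.abs
  have hd' : (0 : ℝ) < d := Nat.cast_pos.mpr hd
  have hπ := Real.pi_pos
  unfold qProb momentumSq hsSq
  rw [expectAdjMul_eq_tsum, expectAdjMul_eq_tsum, div_eq_mul_inv (tsum _) (d : ℝ≥0∞), ← ENNReal.tsum_mul_right, ← ENNReal.tsum_mul_left, ← ENNReal.tsum_add,
    ← ENNReal.tsum_add]
  refine ENNReal.tsum_le_tsum fun n => ?_
  rw [ContinuousLinearMap.comp_apply]
  set ψ := sqrtOp ρ (basis Mode n)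
  rw [dif_pos (mem_domain_qProj hS ψ)]
  by_cases hp : ψ ∈ pOp.domain
  · rw [dif_pos hp, ← div_eq_mul_inv, ← ENNReal.ofReal_natCast d]
    simp only [← ofReal_norm_sq]
    rw [← ENNReal.ofReal_div_of_pos hd', ← ENNReal.ofReal_mul (by positivity),
      ← ENNReal.ofReal_add (by positivity) (by positivity),
      ← ENNReal.ofReal_add (by positivity) (by positivity)]
    refine ENNReal.ofReal_le_ofReal ?_
    rw [norm_sq_qProj hS, ← add_assoc]
    exact norm_sq_le_of_mem_pGraph hd hd2 (pOp_mem_pGraph ⟨ψ, hp⟩)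
  -- Outside the domain of `p̂` the momentum term is `⊤`, and stays so because `1/d` and `2/π` are
  -- nonzero.
  · rw [dif_neg hp, ENNReal.top_mul (ENNReal.inv_ne_zero.mpr (ENNReal.natCast_ne_top d)),
      ENNReal.mul_top (ENNReal.ofReal_pos.mpr (by positivity)).ne', add_top, add_top]
    exact le_top

/-- Let `f` be the tail of `√ρ eₙ`. The kernel vanishes wherever `f(q)` can be nonzero, so `⟨f, ρf⟩
= ‖√ρ f‖² = 0`, and `‖f‖² = ⟨f, √ρ eₙ⟩ = ⟨√ρ f, eₙ⟩ = 0`. This avoids restricting the kernel to the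
diagonal, a null set. -/
lemma qProb_eq_zero_of_supportedIn {ρ : Mode →L[ℂ] Mode} (hρ : 0 ≤ ρ) {R : ℝ}
    (h : SupportedIn ρ R) : qProb ρ {q | R ≤ |q|} = 0 := by
  obtain ⟨K, ⟨-, hK⟩, hKR⟩ := h
  have hS : MeasurableSet {q : ℝ | R ≤ |q|} := measurableSet_le measurable_const measurable_id.abs
  unfold qProb
  rw [expectAdjMul_eq_tsum, ENNReal.tsum_eq_zero]
  intro n
  set ψ := sqrtOp ρ (basis Mode n) with hψ
  rw [dif_pos (mem_domain_qProj hS ψ)]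
  set f := qProj {q : ℝ | R ≤ |q|} ⟨ψ, mem_domain_qProj hS ψ⟩ with hf
  have hfae : ∀ᵐ x, f x = ({q : ℝ | R ≤ |q|}.indicator 1 x : ℂ) * ψ x := coe_mulOp_ae _ ⟨ψ, _⟩
  have hf0 : ∀ᵐ z : ℝ × ℝ, |z.1| < R → f z.1 = 0 := by
    have h1 : ∀ᵐ x, |x| < R → f x = 0 := hfae.mono fun x hx hxR => by simp [hx, hxR]
    rw [Measure.volume_eq_prod]
    exact Measure.quasiMeasurePreserving_fst.ae h1
  have hsym : ∀ x y : Mode, inner ℂ (sqrtOp ρ x) y = inner ℂ x (sqrtOp ρ y) := fun x y => by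
    rw [← ContinuousLinearMap.adjoint_inner_right, adjoint_sqrtOp]
  have hρf : inner ℂ f (ρ f) = 0 := by
    rw [hK]
    refine integral_eq_zero_of_ae ?_
    filter_upwards [hKR, hf0] with z hz1 hz2
    by_cases hz : |z.1| < R
    · simp [hz2 hz]
    · simp [hz1 fun h => hz h.1]
  have hsqrt : sqrtOp ρ f = 0 := by
    rw [← sqrtOp_comp_sqrtOp hρ, ContinuousLinearMap.comp_apply, ← hsym, inner_self_eq_zero] at hρf
    exact hρf
  have hfψ : inner ℂ f ψ = 0 := by rw [hψ, ← hsym, hsqrt, inner_zero_left]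
  have hff : inner ℂ f f = inner ℂ f ψ := by
    rw [L2.inner_def, L2.inner_def]
    refine integral_congr_ae (hfae.mono fun x hx => ?_)
    simp only []
    rw [hx]
    by_cases hxS : x ∈ {q : ℝ | R ≤ |q|}
    · rw [indicator_of_mem hxS, Pi.one_apply, one_mul]
    · rw [indicator_of_notMem hxS, zero_mul, inner_zero_left, inner_zero_left]
  rw [hfψ, inner_self_eq_zero] at hff
  rw [hff, enorm_zero]
  norm_num

lemma traceDist_discretise_le {d : ℕ} (hd : 0 < d) (hd2 : Even d) {ρ : Mode →L[ℂ] Mode}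
    (hρ : IsDensityOperator ρ) (hpos : trace (compress d ρ) ≠ 0) :
    traceDist (discretise d ρ) ρ ≤ (qProb ρ {q | qMax d ≤ |q|} +
      ENNReal.ofReal (2 / Real.pi) * (momentumSq ρ / d)) ^ (1 / 2 : ℝ) := by
  refine (traceDist_compression_le (adjoint_boxProj d) (boxProj_comp_boxProj hd) hρ hpos).trans ?_
  gcongr
  rw [tsub_le_iff_left, ← hρ.2, trace_eq_hsSq_sqrtOp hρ.1]
  exact hsSq_sqrtOp_le hd hd2 ρ

lemma momentum_term_le_photon_term (d : ℕ) {ρ : Mode →L[ℂ] Mode} (hρ : IsDensityOperator ρ) :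
    ENNReal.ofReal (2 / Real.pi) * (momentumSq ρ / d) ≤
      ENNReal.ofReal (4 / Real.pi) * ((meanPhotonNumber ρ + 1 / 2) / d) := by
  have h1 : momentumSq ρ ≤ 2 * (meanPhotonNumber ρ + 1 / 2) := by
    refine (momentumSq_le ρ).trans (le_of_eq ?_)
    rw [← trace_eq_hsSq_sqrtOp hρ.1, hρ.2, mul_add, one_div,
      ENNReal.mul_inv_cancel (by norm_num) (by norm_num)]
  have h2 : ENNReal.ofReal (4 / Real.pi) = ENNReal.ofReal (2 / Real.pi) * 2 := by
    rw [← ENNReal.ofReal_ofNat 2, ← ENNReal.ofReal_mul (by have := Real.pi_pos; positivity)]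
    congr 1
    ring
  rw [h2, mul_assoc, ← mul_div_assoc 2]
  gcongr

end Modes

end CV

end

theorem lemma3 (d : ℕ) (hd : 0 < d) (hd2 : Even d)
    (ρ : CV.Mode →L[ℂ] CV.Mode) (hρ : CV.IsDensityOperator ρ)
    (hpos : CV.trace (CV.compress d ρ) ≠ 0) :
    (CV.SupportedIn ρ (CV.qMax d) →
      CV.traceDist (CV.discretise d ρ) ρ ≤
        (ENNReal.ofReal (2 / Real.pi) * (CV.momentumSq ρ / d)) ^ (1 / 2 : ℝ) ∧
      CV.traceDist (CV.discretise d ρ) ρ ≤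
        (ENNReal.ofReal (4 / Real.pi) * ((CV.meanPhotonNumber ρ + 1 / 2) / d)) ^ (1 / 2 : ℝ)) ∧
    CV.traceDist (CV.discretise d ρ) ρ ≤
      (CV.qProb ρ {q | CV.qMax d ≤ |q|} +
        ENNReal.ofReal (2 / Real.pi) * (CV.momentumSq ρ / d)) ^ (1 / 2 : ℝ) ∧
    CV.traceDist (CV.discretise d ρ) ρ ≤
      (CV.qProb ρ {q | CV.qMax d ≤ |q|} +
        ENNReal.ofReal (4 / Real.pi) * ((CV.meanPhotonNumber ρ + 1 / 2) / d)) ^ (1 / 2 : ℝ) := by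
  have h := CV.traceDist_discretise_le hd hd2 hρ hpos
  have hle := CV.momentum_term_le_photon_term d hρ
  refine ⟨fun hsupp => ?_, h, h.trans (by gcongr)⟩
  rw [CV.qProb_eq_zero_of_supportedIn hρ.1 hsupp, zero_add] at h
  exact ⟨h, h.trans (by gcongr)⟩
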